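/- Let $d$ be a dimension. For a path $\gamma:\mathbb R\to\mathbb R^d$ and $s>0$ write $T_{\gamma,s}=\{(x,t)\in\mathbb R^d\times\mathbb R:\ |x-\gamma(t)|\le s\}$, and let $\mathbf 1_{T_{\gamma,s}}$ be its indicator function. There are constants $r,V,C>0$, depending only on $d$, with the following property. Let $\xi\in\mathbb R^d$ and $\rho>0$, and let $t\mapsto u_t$, a continuous curve in $L^2(\mathbb R^d)$, be a solution (in the sense of tempered distributions) of the Schrödinger equation $$i\partial_t u+\Delta u=0$$ with frequency localization $\operatorname{supp}\widehat{u_0}\subset B_\rho(\xi)$, where $B_\rho(\xi)$ is the closed ball and $\hat f(\eta)=\int f(x)e^{-ix\cdot\eta}\,dx$. Then every $u_t$ has a continuous representative, which is again denoted by $u_t$, and for every $T>0$ there are differentiable paths $\gamma_i:\mathbb R\to\mathbb R^d$ and weights $w_i\ge 0$ ($i=1,2,\dots$) such that $$|\gamma_i'(t)-2\xi|<V\rho\qquad\text{for all } i \text{ and all } t\in\mathbb R,$$ $$|u_t(x)|^2\le\sum_{i=1}^\infty w_i\,\mathbf 1_{T_{\gamma_i,\,r\rho^{-1}}}(x,t)\qquad\text{for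 all }(x,t)\in\mathbb R^d\times[-T,T],$$ and $$\sum_{i=1}^\infty (r\rho^{-1})^d\,w_i\le C\int_{\mathbb R^d}|u_t(x)|^2\,dx\qquad\text{for all } t\in\mathbb R.$$ -/

import Mathlib

open MeasureTheory
open scoped SchwartzMap FourierTransform Laplacian

/-- `u` is an `L²` solution of the free Schrödinger equation `i ∂ₜu + Δu = 0` on `ℝᵈ × ℝ`:
a continuous curve `t ↦ u t` in `L²(ℝᵈ)` which satisfies `∂ₜu = iΔu` in the sense of tempered
distributions, that is, `d/dt ∫ φ u_t = i ∫ (Δφ) u_t` for every Schwartz function `φ`. -/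
def IsSchrodingerSolution {d : ℕ} (u : ℝ → Lp ℂ 2 (volume : Measure (EuclideanSpace ℝ (Fin d)))) :
    Prop :=
  Continuous u ∧
    ∀ (φ : 𝓢(EuclideanSpace ℝ (Fin d), ℂ)) (t : ℝ),
      HasDerivAt (fun s : ℝ => ∫ x, φ x * u s x)
        (Complex.I * ∫ x, (Δ φ) x * u t x) t

/-- The (essential) support of the Fourier transform of `f ∈ L²(ℝᵈ)` is contained in the closed
set `S`, where the Fourier transform is `f̂(ξ) = ∫ f(x) e^{-i x·ξ} dx`. Mathlib's `𝓕` uses the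
kernel `e^{-2πi x·η}`, so that `f̂(2πη) = 𝓕 f η`. -/
def FourierSupportedIn {d : ℕ} (f : Lp ℂ 2 (volume : Measure (EuclideanSpace ℝ (Fin d))))
    (S : Set (EuclideanSpace ℝ (Fin d))) : Prop :=
  ∀ᵐ η : EuclideanSpace ℝ (Fin d), (2 * Real.pi) • η ∉ S → (𝓕 f) η = 0

/-- The tube `T_{γ,r} = {(x,t) : |x - γ(t)| ≤ r}` of width `r` centered at the path `γ`. -/
def tube {d : ℕ} (γ : ℝ → EuclideanSpace ℝ (Fin d)) (r : ℝ) :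
    Set (EuclideanSpace ℝ (Fin d) × ℝ) :=
  {p | ‖p.1 - γ p.2‖ ≤ r}

/-! A Galilean boost and a rescaling move the frequencies into the unit ball, where the claim is
`exists_tubes_wave`. There |u|² obeys the continuity equation ∂ₜ|u|² + div J = 0 with J = 2 Im(ū∇u),
and the tubes follow the flow of mass, coarse-grained to unit cells.

The velocity J/|u|² is unbounded near zeros of u, but its local averages are bounded. Band
limitation makes ∇u a convolution of u with a Schwartz kernel, so the mass of ∇u near a point is
controlled by that of u, provided "near" is measured by a slowly varying weight
(`exists_integral_wave_mul_le`). Polynomial tails absorb the tails of the kernel, which a compact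
cutoff would not. The cells are lattice translates of a product of arctangent differences. Its
partial derivatives are differences of one face weight at neighbouring lattice points, so cell
masses change exactly by fluxes between neighbours (`cellMass_sub_cellMass`), each at most a
constant times the mass of either adjacent cell (`exists_abs_flux_le`).

Hence in a time step depending only on d no cell sends out more mass than it had at the start
(`exists_time_step`). The transport is then a nearest-neighbour Markov chain, and its masses are
superpositions of weighted lattice paths (`exists_paths_of_transition`). Their smooth interpolations
are the tube centres. A value |u(x)|² is controlled by the mass of a nearby cell
(`exists_norm_sq_wave_le`), which has at most doubled since the start of the step; at that start it
was the total weight of the paths in the cell. All paths together weigh at most a constant times the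
conserved L² mass.

Distributional solutions enter through their Fourier transform (`IsSchrodingerSolution.fourier_eq`),
and `fourierInv_eq_galileanWave` supplies the continuous representative. -/

/-! ### Polynomially decaying weights and the arctangent partition of unity -/

/-- The one-dimensional weight `1 / (1 + s²)`. -/
noncomputable def wt (s : ℝ) : ℝ := (1 + s ^ 2)⁻¹

/-- The average of `wt` over the unit interval centred at `s`. -/
noncomputable def bump (s : ℝ) : ℝ := Real.arctan (s + 1 / 2) - Real.arctan (s - 1 / 2)

lemma wt_pos (s : ℝ) : 0 < wt s := by unfold wt; positivity

lemma wt_le_one (s : ℝ) : wt s ≤ 1 := by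
  unfold wt
  exact inv_le_one_of_one_le₀ (by nlinarith [sq_nonneg s])

/-- From s = (s + a) - a one has s² ≤ 2(s + a)² + 2a². Translating the weight thus costs only a
polynomial factor in the shift; this is the slow variation used throughout. -/
lemma wt_add_le (s a : ℝ) : wt (s + a) ≤ 2 * (1 + a ^ 2) * wt s := by
  unfold wt
  rw [← div_eq_mul_inv, inv_eq_one_div, div_le_div_iff₀ (by positivity) (by positivity)]
  nlinarith [sq_nonneg (s + a + a), sq_nonneg (a * (s + a)), sq_nonneg (s + 2 * a), sq_nonneg a]

lemma continuous_wt : Continuous wt := by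
  unfold wt
  exact Continuous.inv₀ (by fun_prop) (fun s => by positivity)

lemma continuous_bump : Continuous bump := by
  unfold bump
  fun_prop

lemma hasDerivAt_bump (s : ℝ) : HasDerivAt bump (wt (s + 1 / 2) - wt (s - 1 / 2)) s := by
  have h1 : HasDerivAt (fun s : ℝ => Real.arctan (s + 1 / 2)) (wt (s + 1 / 2)) s := by
    exact ((hasDerivAt_id s).add_const (1 / 2)).arctan.congr_deriv (by simp [wt])
  have h2 : HasDerivAt (fun s : ℝ => Real.arctan (s - 1 / 2)) (wt (s - 1 / 2)) s := by
    exact ((hasDerivAt_id s).sub_const (1 / 2)).arctan.congr_deriv (by simp [wt])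
  exact h1.sub h2

/-- Mean value theorem for arctan; it makes `bump` and `wt` comparable. -/
lemma exists_bump_eq (s : ℝ) : ∃ a : ℝ, |a| ≤ 1 / 2 ∧ bump s = wt (s + a) := by
  obtain ⟨c, hc, h⟩ := exists_hasDerivAt_eq_slope Real.arctan (fun x => 1 / (1 + x ^ 2))
    (show s - 1 / 2 < s + 1 / 2 by linarith) Real.continuous_arctan.continuousOn
    (fun x _ => Real.hasDerivAt_arctan x)
  refine ⟨c - s, abs_le.2 ⟨by linarith [hc.1], by linarith [hc.2]⟩, ?_⟩
  have : s + 1 / 2 - (s - 1 / 2) = 1 := by ring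
  rw [this, div_one] at h
  rw [bump, ← h, wt, add_sub_cancel, one_div]

lemma bump_pos (s : ℝ) : 0 < bump s := by
  obtain ⟨a, -, h⟩ := exists_bump_eq s
  rw [h]
  exact wt_pos _

lemma wt_add_le_of_abs_le {s a : ℝ} (ha : |a| ≤ 1 / 2) : wt (s + a) ≤ 5 / 2 * wt s := by
  have h : a ^ 2 ≤ 1 / 4 := by
    have := sq_le_sq' (abs_le.1 ha).1 (abs_le.1 ha).2
    linarith
  exact (wt_add_le s a).trans (mul_le_mul_of_nonneg_right (by linarith) (wt_pos s).le)

lemma bump_le (s : ℝ) : bump s ≤ 5 / 2 * wt s := by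
  obtain ⟨a, ha, h⟩ := exists_bump_eq s
  rw [h]
  exact wt_add_le_of_abs_le ha

lemma wt_le_bump (s : ℝ) : wt s ≤ 5 / 2 * bump s := by
  obtain ⟨a, ha, h⟩ := exists_bump_eq s
  rw [h]
  simpa using wt_add_le_of_abs_le (s := s + a) (a := -a) (by rwa [abs_neg])

lemma wt_half_le (s : ℝ) : wt (s + 1 / 2) ≤ 5 / 2 * wt s :=
  wt_add_le_of_abs_le (by norm_num [abs_of_pos])

lemma wt_neg_half_le (s : ℝ) : wt (s - 1 / 2) ≤ 5 / 2 * wt s := by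
  rw [sub_eq_add_neg]
  exact wt_add_le_of_abs_le (by norm_num [abs_neg, abs_of_pos])

lemma sum_bump_Ico (s : ℝ) (a : ℤ) (n : ℕ) :
    ∑ k ∈ Finset.Ico a (a + n), bump (s - k) =
      Real.arctan (s - a + 1 / 2) - Real.arctan (s - a - n + 1 / 2) := by
  induction n with
  | zero => simp
  | succ n ih =>
    have : Finset.Ico a (a + (n + 1 : ℕ)) = insert (a + n : ℤ) (Finset.Ico a (a + n)) := by
      ext x; simp; omega
    rw [this, Finset.sum_insert (by simp), ih, bump]
    push_cast
    have e1 : s - (↑a + ↑n) + 1 / 2 = s - a - n + 1 / 2 := by ring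
    have e2 : s - (↑a + ↑n) - 1 / 2 = s - a - (n + 1) + 1 / 2 := by ring
    rw [e1, e2]
    ring

lemma sum_bump_le (s : ℝ) (t : Finset ℤ) : ∑ k ∈ t, bump (s - k) ≤ Real.pi := by
  -- The terms are positive, so the finite set may be enlarged to an interval, where the sum
  -- telescopes.
  obtain ⟨a, n, h⟩ : ∃ (a : ℤ) (n : ℕ), t ⊆ Finset.Ico a (a + n) := by
    obtain ⟨b, hb⟩ := t.bddBelow
    obtain ⟨c, hc⟩ := t.bddAbove
    refine ⟨b, (c + 1 - b).toNat, fun x hx => ?_⟩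
    have h1 := hb hx
    have h2 := hc hx
    simp only [Finset.mem_Ico]
    omega
  refine (Finset.sum_le_sum_of_subset_of_nonneg h fun _ _ _ => (bump_pos _).le).trans ?_
  rw [sum_bump_Ico]
  linarith [Real.arctan_lt_pi_div_two (s - a + 1 / 2),
    Real.neg_pi_div_two_lt_arctan (s - a - n + 1 / 2)]

variable {d : ℕ}

/-- The product weight on `ℝᵈ`. -/
noncomputable def prodWt (x : EuclideanSpace ℝ (Fin d)) : ℝ := ∏ i, wt (x i)

/-- The product of the one-dimensional bumps. -/
noncomputable def prodBump (x : EuclideanSpace ℝ (Fin d)) : ℝ := ∏ i, bump (x i)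

/-- The weight of the face in direction `j`; its differences are the derivatives of
`prodBump`. -/
noncomputable def faceWt (j : Fin d) (x : EuclideanSpace ℝ (Fin d)) : ℝ :=
  wt (x j + 1 / 2) * ∏ i ∈ Finset.univ.erase j, bump (x i)

/-- The lattice point of `ℝᵈ` with integer coordinates `k`. -/
noncomputable def latticePt (k : Fin d → ℤ) : EuclideanSpace ℝ (Fin d) :=
  WithLp.toLp 2 fun i => (k i : ℝ)

@[simp] lemma latticePt_apply (k : Fin d → ℤ) (i : Fin d) : latticePt k i = k i := rfl

lemma prodWt_pos (x : EuclideanSpace ℝ (Fin d)) : 0 < prodWt x :=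
  Finset.prod_pos fun _ _ => wt_pos _

lemma prodBump_pos (x : EuclideanSpace ℝ (Fin d)) : 0 < prodBump x :=
  Finset.prod_pos fun _ _ => bump_pos _

lemma faceWt_nonneg (j : Fin d) (x : EuclideanSpace ℝ (Fin d)) : 0 ≤ faceWt j x :=
  mul_nonneg (wt_pos _).le (Finset.prod_nonneg fun _ _ => (bump_pos _).le)

lemma prodWt_le_one (x : EuclideanSpace ℝ (Fin d)) : prodWt x ≤ 1 :=
  Finset.prod_le_one (fun _ _ => (wt_pos _).le) fun _ _ => wt_le_one _

lemma continuous_prodWt : Continuous (prodWt (d := d)) :=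
  continuous_finsetProd _ fun i _ => continuous_wt.comp (by fun_prop)

lemma continuous_prodBump : Continuous (prodBump (d := d)) :=
  continuous_finsetProd _ fun i _ => continuous_bump.comp (by fun_prop)

lemma continuous_faceWt (j : Fin d) : Continuous (faceWt j) :=
  (continuous_wt.comp (by fun_prop)).mul
    (continuous_finsetProd _ fun i _ => continuous_bump.comp (by fun_prop))

lemma prodWt_le_prodBump (x : EuclideanSpace ℝ (Fin d)) :
    prodWt x ≤ (5 / 2) ^ d * prodBump x := by
  calc prodWt x ≤ ∏ i : Fin d, 5 / 2 * bump (x i) :=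
        Finset.prod_le_prod (fun _ _ => (wt_pos _).le) fun _ _ => wt_le_bump _
    _ = _ := by simp [Finset.prod_mul_distrib, prodBump, div_pow]

lemma prodBump_le_prodWt (x : EuclideanSpace ℝ (Fin d)) :
    prodBump x ≤ (5 / 2) ^ d * prodWt x := by
  calc prodBump x ≤ ∏ i : Fin d, 5 / 2 * wt (x i) :=
        Finset.prod_le_prod (fun _ _ => (bump_pos _).le) fun _ _ => bump_le _
    _ = _ := by simp [Finset.prod_mul_distrib, prodWt, div_pow]

lemma mul_prod_erase_bump_le (j : Fin d) (x : EuclideanSpace ℝ (Fin d)) {a : ℝ}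
    (ha : a ≤ 5 / 2 * wt (x j)) :
    a * ∏ i ∈ Finset.univ.erase j, bump (x i) ≤ (5 / 2) ^ d * prodWt x := by
  have hp : (5 / 2 : ℝ) ^ d * prodWt x = ∏ i : Fin d, 5 / 2 * wt (x i) := by
    simp [Finset.prod_mul_distrib, prodWt, div_pow]
  rw [hp, ← Finset.mul_prod_erase Finset.univ _ (Finset.mem_univ j)]
  refine mul_le_mul ha (Finset.prod_le_prod (fun _ _ => (bump_pos _).le) fun _ _ => bump_le _)
    (Finset.prod_nonneg fun _ _ => (bump_pos _).le) ?_
  have := wt_pos (x j)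
  positivity

lemma faceWt_le (j : Fin d) (x : EuclideanSpace ℝ (Fin d)) :
    faceWt j x ≤ (5 / 2) ^ d * prodWt x :=
  mul_prod_erase_bump_le j x (wt_half_le _)

lemma faceWt_sub_single (j : Fin d) (x : EuclideanSpace ℝ (Fin d)) :
    faceWt j (x - EuclideanSpace.single j 1) =
      wt (x j - 1 / 2) * ∏ i ∈ Finset.univ.erase j, bump (x i) := by
  unfold faceWt
  congr 1
  · simp; congr 1; ring
  · refine Finset.prod_congr rfl fun i hi => ?_
    simp [Finset.ne_of_mem_erase hi]

lemma faceWt_sub_single_le (j : Fin d) (x : EuclideanSpace ℝ (Fin d)) :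
    faceWt j (x - EuclideanSpace.single j 1) ≤ (5 / 2) ^ d * prodWt x := by
  rw [faceWt_sub_single]
  exact mul_prod_erase_bump_le j x (wt_neg_half_le _)

/-- Since `bump` is a difference of arctangents at distance one, the derivative is one face weight
minus its own unit translate. Neighbouring cells therefore share a face weight exactly, and flux
leaving one enters the other. -/
lemma hasLineDerivAt_prodBump (j : Fin d) (x : EuclideanSpace ℝ (Fin d)) :
    HasLineDerivAt ℝ prodBump (faceWt j x - faceWt j (x - EuclideanSpace.single j 1)) x
      (EuclideanSpace.single j 1) := by
  have h : (fun t : ℝ => prodBump (x + t • EuclideanSpace.single j (1 : ℝ))) =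
      fun t => bump (x j + t) * ∏ i ∈ Finset.univ.erase j, bump (x i) := by
    funext t
    rw [prodBump, ← Finset.mul_prod_erase Finset.univ _ (Finset.mem_univ j)]
    congr 1
    · simp
    · refine Finset.prod_congr rfl fun i hi => ?_
      simp [Finset.ne_of_mem_erase hi]
  unfold HasLineDerivAt
  rw [h, faceWt_sub_single, faceWt, ← sub_mul]
  refine HasDerivAt.mul_const ?_ _
  have := (hasDerivAt_bump (x j + 0)).comp_const_add (x j) 0
  simpa using this

lemma prodWt_add_le (x y : EuclideanSpace ℝ (Fin d)) :
    prodWt (x + y) ≤ 2 ^ d * (prodWt y)⁻¹ * prodWt x := by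
  calc prodWt (x + y) ≤ ∏ i : Fin d, 2 * (wt (y i))⁻¹ * wt (x i) := by
        refine Finset.prod_le_prod (fun _ _ => (wt_pos _).le) fun i _ => ?_
        simpa [wt] using wt_add_le (x i) (y i)
    _ = _ := by simp [Finset.prod_mul_distrib, prodWt]

lemma inv_prodWt_le (x : EuclideanSpace ℝ (Fin d)) : (prodWt x)⁻¹ ≤ (1 + ‖x‖) ^ (2 * d) := by
  calc (prodWt x)⁻¹ = ∏ i : Fin d, (1 + x i ^ 2) := by simp [prodWt, wt]
    _ ≤ ∏ _i : Fin d, (1 + ‖x‖) ^ 2 := by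
        refine Finset.prod_le_prod (fun _ _ => by positivity) fun i _ => ?_
        have h := PiLp.norm_apply_le x i
        have h' : x i ^ 2 ≤ ‖x‖ ^ 2 := by
          rw [← sq_abs, ← Real.norm_eq_abs]
          gcongr
        nlinarith [norm_nonneg x]
    _ = _ := by simp [pow_mul]

lemma sum_prodBump_le (x : EuclideanSpace ℝ (Fin d)) (s : Finset (Fin d → ℤ)) :
    ∑ k ∈ s, prodBump (x - latticePt k) ≤ Real.pi ^ d := by
  -- Enlarged to a box, the sum factors into one-dimensional sums.
  have hs : s ⊆ Fintype.piFinset fun i => s.image fun k => k i := fun k hk => by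
    simp only [Fintype.mem_piFinset, Finset.mem_image]
    exact fun i => ⟨k, hk, rfl⟩
  refine (Finset.sum_le_sum_of_subset_of_nonneg hs fun _ _ _ => (prodBump_pos _).le).trans ?_
  have : ∀ k : Fin d → ℤ, prodBump (x - latticePt k) = ∏ i, bump (x i - k i) := fun k => by
    simp [prodBump]
  simp_rw [this]
  rw [← Finset.prod_univ_sum (fun i => s.image fun k => k i) fun i n => bump (x i - (n : ℤ))]
  calc _ ≤ ∏ _i : Fin d, Real.pi :=
        Finset.prod_le_prod (fun _ _ => Finset.sum_nonneg fun _ _ => (bump_pos _).le)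
          fun i _ => sum_bump_le _ _
    _ = _ := by simp

/-! ### The inverse Fourier integral on `L¹ ∩ L²` -/

lemma integral_fourierInv_mul_eq_of_integrable {f g : EuclideanSpace ℝ (Fin d) → ℂ}
    (hf : Integrable f) (hg : Integrable g) :
    ∫ x, 𝓕⁻ f x * g x = ∫ x, f x * 𝓕⁻ g x := by
  have h := VectorFourier.integral_fourierIntegral_smul_eq_flip (μ := volume) (ν := volume)
    (L := -innerₗ (EuclideanSpace ℝ (Fin d))) (f := f) (g := g)
    Real.continuous_fourierChar (by simpa using! continuous_inner.neg) hf hg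
  have hflip : (-innerₗ (EuclideanSpace ℝ (Fin d))).flip = -innerₗ (EuclideanSpace ℝ (Fin d)) := by
    ext x y
    simp [real_inner_comm]
  rw [hflip] at h
  simpa using! h

lemma integral_fourier_mul_Lp_eq (φ : 𝓢(EuclideanSpace ℝ (Fin d), ℂ))
    (f : Lp ℂ 2 (volume : Measure (EuclideanSpace ℝ (Fin d)))) :
    ∫ x, (𝓕 φ) x * f x = ∫ x, φ x * (𝓕 f) x := by
  have h := DFunLike.congr_fun (Lp.fourier_toTemperedDistribution_eq f) φ
  rw [TemperedDistribution.fourier_apply, Lp.toTemperedDistribution_apply,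
    Lp.toTemperedDistribution_apply] at h
  simpa only [smul_eq_mul] using h

/-- Both sides agree against test functions: the transform is moved off `f` by L² duality and onto
`g` by Fubini in L¹. -/
lemma fourierInv_ae_eq_of_integrable_of_memLp {g : EuclideanSpace ℝ (Fin d) → ℂ}
    (h1 : Integrable g) (f : Lp ℂ 2 (volume : Measure (EuclideanSpace ℝ (Fin d))))
    (hf : ∀ᵐ x, (𝓕 f) x = g x) : f =ᵐ[volume] 𝓕⁻ g := by
  refine ae_eq_of_integral_contDiff_smul_eq ?_ ?_ fun φ hφ hφc => ?_
  · exact (Lp.memLp f).locallyIntegrable (by norm_num)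
  · have : Continuous (𝓕⁻ g) := VectorFourier.fourierIntegral_continuous
      Real.continuous_fourierChar (by simpa using! continuous_inner.neg) h1
    exact this.locallyIntegrable
  · have hc : HasCompactSupport fun x => (φ x : ℂ) := hφc.comp_left (g := Complex.ofReal) rfl
    set ψ : 𝓢(EuclideanSpace ℝ (Fin d), ℂ) :=
      hc.toSchwartzMap (Complex.ofRealCLM.contDiff.comp hφ) with hψ
    have e : ∀ x, ψ x = φ x := fun x => rfl
    have h2 := integral_fourier_mul_Lp_eq (𝓕⁻ ψ) f
    rw [FourierTransform.fourier_fourierInv_eq] at h2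
    have h3 := integral_fourierInv_mul_eq_of_integrable ψ.integrable h1
    simp only [Complex.real_smul]
    calc ∫ x, (φ x : ℂ) * f x = ∫ x, (𝓕⁻ ψ : 𝓢(EuclideanSpace ℝ (Fin d), ℂ)) x *
          (𝓕 f : Lp ℂ 2 (volume : Measure (EuclideanSpace ℝ (Fin d)))) x := h2
      _ = ∫ x, (𝓕⁻ ψ : 𝓢(EuclideanSpace ℝ (Fin d), ℂ)) x * g x := by
        refine integral_congr_ae ?_
        filter_upwards [hf] with x hx
        rw [hx]
      _ = ∫ x, ψ x * 𝓕⁻ g x := by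
        rw [← h3, SchwartzMap.fourierInv_coe]

lemma fourierInv_ae_eq_toLp {g : EuclideanSpace ℝ (Fin d) → ℂ}
    (h1 : Integrable g) (h2 : MemLp g 2) :
    (𝓕⁻ h2.toLp : Lp ℂ 2 (volume : Measure (EuclideanSpace ℝ (Fin d)))) =ᵐ[volume] 𝓕⁻ g := by
  refine fourierInv_ae_eq_of_integrable_of_memLp h1 _ ?_
  rw [FourierTransform.fourier_fourierInv_eq]
  exact h2.coeFn_toLp

lemma memLp_fourierInv {g : EuclideanSpace ℝ (Fin d) → ℂ} (h1 : Integrable g)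
    (h2 : MemLp g 2) : MemLp (𝓕⁻ g) 2 :=
  (memLp_congr_ae (fourierInv_ae_eq_toLp h1 h2)).1 (Lp.memLp _)

lemma integral_norm_sq_eq_norm_sq (f : Lp ℂ 2 (volume : Measure (EuclideanSpace ℝ (Fin d)))) :
    ∫ x, ‖f x‖ ^ 2 = ‖f‖ ^ 2 := by
  rw [← inner_self_eq_norm_sq (𝕜 := ℂ) f, L2.inner_def]
  simp_rw [inner_self_eq_norm_sq_to_K]
  rw [← RCLike.ofReal_re (K := ℂ) (∫ x, ‖f x‖ ^ 2)]
  congr 1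
  rw [← integral_ofReal]
  simp

lemma integral_norm_sq_fourierInv {g : EuclideanSpace ℝ (Fin d) → ℂ} (h1 : Integrable g)
    (h2 : MemLp g 2) : ∫ x, ‖𝓕⁻ g x‖ ^ 2 = ∫ x, ‖g x‖ ^ 2 := by
  calc ∫ x, ‖𝓕⁻ g x‖ ^ 2 =
        ∫ x, ‖(𝓕⁻ h2.toLp : Lp ℂ 2 (volume : Measure (EuclideanSpace ℝ (Fin d)))) x‖ ^ 2 := by
        refine integral_congr_ae ?_
        filter_upwards [fourierInv_ae_eq_toLp h1 h2] with x hx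
        rw [hx]
    _ = ‖h2.toLp‖ ^ 2 := by
        rw [integral_norm_sq_eq_norm_sq, ← Lp.norm_fourier_eq,
          FourierTransform.fourier_fourierInv_eq]
    _ = ∫ x, ‖g x‖ ^ 2 := by
        rw [← integral_norm_sq_eq_norm_sq]
        refine integral_congr_ae ?_
        filter_upwards [h2.coeFn_toLp] with x hx
        rw [hx]

/-! ### Free Schrödinger waves with frequencies in the unit ball -/

/-- The free Schrödinger wave with amplitude `G` on the frequency side. -/
noncomputable def wave (G : EuclideanSpace ℝ (Fin d) → ℂ) (s : ℝ) (y : EuclideanSpace ℝ (Fin d)) :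
    ℂ :=
  ∫ ζ, Complex.exp (Complex.I * ((2 * Real.pi * inner ℝ y ζ - 4 * Real.pi ^ 2 * s * ‖ζ‖ ^ 2 : ℝ) : ℂ))
    * G ζ

/-- Square integrable amplitudes which vanish outside the unit ball. -/
structure BandLimited (G : EuclideanSpace ℝ (Fin d) → ℂ) : Prop where
  memLp : MemLp G 2
  eq_zero : ∀ ζ, 1 < ‖ζ‖ → G ζ = 0

lemma norm_exp_I_mul_ofReal_mul (a : ℝ) (z : ℂ) : ‖Complex.exp (Complex.I * a) * z‖ = ‖z‖ := by
  rw [norm_mul, mul_comm Complex.I, Complex.norm_exp_ofReal_mul_I, one_mul]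

namespace BandLimited

variable {G : EuclideanSpace ℝ (Fin d) → ℂ}

lemma integrable (h : BandLimited G) : Integrable G := by
  have h1 : IntegrableOn G (Metric.closedBall 0 1) := by
    have : MemLp G 2 (volume.restrict (Metric.closedBall 0 1)) := h.memLp.restrict _
    have hf : IsFiniteMeasure
      (volume.restrict (Metric.closedBall (0 : EuclideanSpace ℝ (Fin d)) 1)) :=
      ⟨by simpa using measure_closedBall_lt_top⟩
    exact this.integrable (by norm_num)
  refine (integrableOn_iff_integrable_of_support_subset fun ζ hζ => ?_).1 h1
  by_contra hc
  exact hζ (h.eq_zero ζ (by simpa using hc))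

lemma mul (h : BandLimited G) {a : EuclideanSpace ℝ (Fin d) → ℂ} (ha : Continuous a) :
    BandLimited fun ζ => a ζ * G ζ := by
  obtain ⟨C, hC⟩ := (isCompact_closedBall (0 : EuclideanSpace ℝ (Fin d)) 1).exists_bound_of_continuousOn
    ha.continuousOn
  refine ⟨h.memLp.of_le_mul (c := C) (ha.aestronglyMeasurable.mul h.memLp.1) (ae_of_all _ fun ζ => ?_),
    fun ζ hζ => by simp [h.eq_zero ζ hζ]⟩
  by_cases hζ : 1 < ‖ζ‖
  · simp [h.eq_zero ζ hζ]
  · rw [norm_mul]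
    exact mul_le_mul_of_nonneg_right (hC ζ (by simpa using hζ)) (norm_nonneg _)

end BandLimited

/-- The exponential is unimodular, so |b F| dominates the derivative for every τ. Time derivatives,
space derivatives and the solution formula all reduce to this. -/
lemma hasDerivAt_integral_exp_mul {F : EuclideanSpace ℝ (Fin d) → ℂ}
    {b : EuclideanSpace ℝ (Fin d) → ℝ} (hb : Continuous b) (hF : Integrable F)
    (hbF : Integrable fun ζ => (b ζ : ℂ) * F ζ) (τ : ℝ) :
    HasDerivAt (fun τ : ℝ => ∫ ζ, Complex.exp (Complex.I * (τ * b ζ : ℝ)) * F ζ)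
      (∫ ζ, Complex.exp (Complex.I * (τ * b ζ : ℝ)) * (Complex.I * b ζ * F ζ)) τ := by
  have hm : ∀ τ : ℝ, AEStronglyMeasurable
      (fun ζ => Complex.exp (Complex.I * (τ * b ζ : ℝ))) volume := fun τ =>
    Continuous.aestronglyMeasurable (by fun_prop)
  refine (hasDerivAt_integral_of_dominated_loc_of_deriv_le (s := Set.univ)
    (bound := fun ζ => ‖(b ζ : ℂ) * F ζ‖) Filter.univ_mem
    (F := fun (τ : ℝ) ζ => Complex.exp (Complex.I * (τ * b ζ : ℝ)) * F ζ)
    (F' := fun (τ : ℝ) ζ => Complex.exp (Complex.I * (τ * b ζ : ℝ)) * (Complex.I * b ζ * F ζ))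
    (Filter.Eventually.of_forall fun τ => (hm τ).mul hF.1) ?_ ?_ ?_ hbF.norm ?_).2
  · refine hF.mono ((hm τ).mul hF.1) (ae_of_all _ fun ζ => ?_)
    rw [norm_exp_I_mul_ofReal_mul]
  · refine (hm τ).mul ?_
    simp_rw [mul_assoc]
    exact hbF.1.const_mul _
  · refine ae_of_all _ fun ζ τ _ => ?_
    rw [norm_exp_I_mul_ofReal_mul, mul_assoc, norm_mul Complex.I, Complex.norm_I, one_mul]
  · refine ae_of_all _ fun ζ τ _ => ?_
    have h1 : HasDerivAt (fun τ : ℝ => Complex.I * ((τ * b ζ : ℝ) : ℂ)) (Complex.I * b ζ) τ := by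
      have := ((hasDerivAt_id τ).mul_const (b ζ)).ofReal_comp.const_mul Complex.I
      simpa using! this
    refine (h1.cexp.mul_const (F ζ)).congr_deriv ?_
    ring

section Wave

variable {G : EuclideanSpace ℝ (Fin d) → ℂ}

lemma hasDerivAt_wave (hG : BandLimited G) (s : ℝ) (y : EuclideanSpace ℝ (Fin d)) :
    HasDerivAt (fun s => wave G s y)
      (wave (fun ζ => -(Complex.I * (4 * Real.pi ^ 2 * ‖ζ‖ ^ 2 : ℝ)) * G ζ) s y) s := by
  -- The spatial phase is absorbed into the amplitude, leaving only the time phase as parameter.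
  have hF := hG.mul (a := fun ζ => Complex.exp (Complex.I * (2 * Real.pi * inner ℝ y ζ : ℝ)))
    (by fun_prop)
  have hb : Continuous fun ζ : EuclideanSpace ℝ (Fin d) => -(4 * Real.pi ^ 2 * ‖ζ‖ ^ 2) := by
    fun_prop
  have h := hasDerivAt_integral_exp_mul hb hF.integrable (hF.mul (by fun_prop)).integrable s
  refine (h.congr_deriv ?_).congr_of_eventuallyEq (Filter.Eventually.of_forall fun s => ?_)
  · unfold wave
    refine integral_congr_ae (ae_of_all _ fun ζ => ?_)
    simp only
    rw [show ((2 * Real.pi * inner ℝ y ζ - 4 * Real.pi ^ 2 * s * ‖ζ‖ ^ 2 : ℝ) : ℂ) =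
      ((s * -(4 * Real.pi ^ 2 * ‖ζ‖ ^ 2) : ℝ) : ℂ) + ((2 * Real.pi * inner ℝ y ζ : ℝ) : ℂ) by
      push_cast; ring, mul_add, Complex.exp_add]
    push_cast
    ring
  · unfold wave
    refine integral_congr_ae (ae_of_all _ fun ζ => ?_)
    simp only
    rw [← mul_assoc, ← Complex.exp_add, ← mul_add]
    congr 3
    push_cast
    ring

lemma hasLineDerivAt_wave (hG : BandLimited G) (s : ℝ) (y : EuclideanSpace ℝ (Fin d))
    (j : Fin d) :
    HasLineDerivAt ℝ (wave G s)
      (wave (fun ζ => Complex.I * (2 * Real.pi * ζ j : ℝ) * G ζ) s y) y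
      (EuclideanSpace.single j 1) := by
  have hF := hG.mul (a := fun ζ => Complex.exp (Complex.I *
    ((2 * Real.pi * inner ℝ y ζ - 4 * Real.pi ^ 2 * s * ‖ζ‖ ^ 2 : ℝ) : ℂ))) (by fun_prop)
  have hb : Continuous fun ζ : EuclideanSpace ℝ (Fin d) => 2 * Real.pi * ζ j := by
    fun_prop
  have h := hasDerivAt_integral_exp_mul hb hF.integrable (hF.mul (by fun_prop)).integrable 0
  unfold HasLineDerivAt
  refine (h.congr_deriv ?_).congr_of_eventuallyEq (Filter.Eventually.of_forall fun s => ?_)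
  · unfold wave
    refine integral_congr_ae (ae_of_all _ fun ζ => ?_)
    simp
    ring
  · unfold wave
    refine integral_congr_ae (ae_of_all _ fun ζ => ?_)
    simp only
    rw [← mul_assoc, ← Complex.exp_add, ← mul_add]
    congr 3
    rw [inner_add_left, inner_smul_left, EuclideanSpace.inner_single_left]
    simp
    ring

lemma continuous_wave (hG : BandLimited G) :
    Continuous fun p : ℝ × EuclideanSpace ℝ (Fin d) => wave G p.1 p.2 := by
  unfold wave
  refine continuous_of_dominated (bound := fun ζ => ‖G ζ‖) (fun p => ?_) (fun p => ?_)
    hG.integrable.norm ?_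
  · exact (Continuous.aestronglyMeasurable (by fun_prop)).mul hG.memLp.1
  · exact ae_of_all _ fun ζ => (norm_exp_I_mul_ofReal_mul _ _).le
  · exact ae_of_all _ fun ζ => by fun_prop

lemma continuous_wave_apply (hG : BandLimited G) (s : ℝ) : Continuous (wave G s) := by
  have h := continuous_wave hG
  generalize wave G = f at h ⊢
  exact h.comp (Continuous.prodMk_right s)

lemma wave_eq_fourierInv (G : EuclideanSpace ℝ (Fin d) → ℂ) (s : ℝ) :
    wave G s = 𝓕⁻ fun ζ =>
      Complex.exp (Complex.I * ((-(4 * Real.pi ^ 2 * s * ‖ζ‖ ^ 2) : ℝ) : ℂ)) * G ζ := by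
  funext y
  rw [Real.fourierInv_eq', wave]
  refine integral_congr_ae (ae_of_all _ fun ζ => ?_)
  simp only [smul_eq_mul]
  rw [← mul_assoc, ← Complex.exp_add]
  congr 2
  rw [real_inner_comm]
  push_cast
  ring

lemma memLp_wave (hG : BandLimited G) (s : ℝ) : MemLp (wave G s) 2 := by
  have h := hG.mul (a := fun ζ =>
    Complex.exp (Complex.I * ((-(4 * Real.pi ^ 2 * s * ‖ζ‖ ^ 2) : ℝ) : ℂ))) (by fun_prop)
  rw [wave_eq_fourierInv]
  exact memLp_fourierInv h.integrable h.memLp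

lemma integral_norm_sq_wave (hG : BandLimited G) (s : ℝ) :
    ∫ y, ‖wave G s y‖ ^ 2 = ∫ ζ, ‖G ζ‖ ^ 2 := by
  have h := hG.mul (a := fun ζ =>
    Complex.exp (Complex.I * ((-(4 * Real.pi ^ 2 * s * ‖ζ‖ ^ 2) : ℝ) : ℂ))) (by fun_prop)
  rw [wave_eq_fourierInv, integral_norm_sq_fourierInv h.integrable h.memLp]
  simp_rw [norm_exp_I_mul_ofReal_mul]

lemma integrable_norm_sq_wave (hG : BandLimited G) (s : ℝ) :
    Integrable fun y => ‖wave G s y‖ ^ 2 :=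
  (memLp_wave hG s).integrable_norm_pow (by norm_num)

/-- Smooth Fourier multipliers act on waves by convolution with a Schwartz kernel. -/
lemma wave_mul_eq_integral (hG : BandLimited G) (a : 𝓢(EuclideanSpace ℝ (Fin d), ℂ)) (s : ℝ)
    (y : EuclideanSpace ℝ (Fin d)) :
    wave (fun ζ => a ζ * G ζ) s y = ∫ z, (𝓕⁻ a) (y - z) * wave G s z := by
  have h := hG.mul (a := fun ζ =>
    Complex.exp (Complex.I * ((-(4 * Real.pi ^ 2 * s * ‖ζ‖ ^ 2) : ℝ) : ℂ))) (by fun_prop)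
  have hK : Integrable fun z => (𝓕⁻ a) (y - z) := (𝓕⁻ a).integrable.comp_sub_left y
  rw [wave_eq_fourierInv G, ← integral_fourierInv_mul_eq_of_integrable hK h.integrable, wave]
  refine integral_congr_ae (ae_of_all _ fun ζ => ?_)
  have key : 𝓕⁻ (fun z => (𝓕⁻ a : 𝓢(EuclideanSpace ℝ (Fin d), ℂ)) (y - z)) ζ =
      Complex.exp (Complex.I * (2 * Real.pi * inner ℝ y ζ : ℝ)) * a ζ := by
    have ha : a ζ = 𝓕 (𝓕⁻ (a : EuclideanSpace ℝ (Fin d) → ℂ)) ζ := by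
      rw [← SchwartzMap.fourierInv_coe, ← SchwartzMap.fourier_coe,
        FourierTransform.fourier_fourierInv_eq]
    rw [Real.fourierInv_eq', ha, Real.fourier_eq', ← integral_const_mul,
      ← integral_sub_left_eq_self _ volume y]
    refine integral_congr_ae (ae_of_all _ fun z => ?_)
    simp only [smul_eq_mul, sub_sub_cancel, SchwartzMap.fourierInv_coe]
    rw [← mul_assoc, ← Complex.exp_add]
    congr 2
    rw [inner_sub_left]
    push_cast
    ring
  simp only [key]
  rw [show ((2 * Real.pi * inner ℝ y ζ - 4 * Real.pi ^ 2 * s * ‖ζ‖ ^ 2 : ℝ) : ℂ) =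
      ((2 * Real.pi * inner ℝ y ζ : ℝ) : ℂ) + ((-(4 * Real.pi ^ 2 * s * ‖ζ‖ ^ 2) : ℝ) : ℂ) by
      push_cast; ring, mul_add, Complex.exp_add]
  ring

end Wave

/-! ### Weighted estimates for convolutions with Schwartz kernels -/

lemma SchwartzMap.exists_norm_le_prodWt (K : 𝓢(EuclideanSpace ℝ (Fin d), ℂ)) :
    ∃ B, 0 ≤ B ∧ ∀ z, ‖K z‖ ≤ B * prodWt z := by
  refine ⟨2 ^ (2 * d) * (Finset.Iic (2 * d, 0)).sup
    (fun m => SchwartzMap.seminorm ℂ m.1 m.2) K, by positivity, fun z => ?_⟩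
  have h := SchwartzMap.one_add_le_sup_seminorm_apply (𝕜 := ℂ) (m := (2 * d, 0)) (k := 2 * d)
    (n := 0) le_rfl le_rfl K z
  rw [norm_iteratedFDeriv_zero] at h
  have h2 := (mul_le_mul_of_nonneg_right (inv_prodWt_le z) (norm_nonneg (K z))).trans h
  rwa [inv_mul_le_iff₀ (prodWt_pos z), mul_comm (prodWt z)] at h2

lemma SchwartzMap.integrable_norm_mul_inv_prodWt (K : 𝓢(EuclideanSpace ℝ (Fin d), ℂ)) :
    Integrable fun z => ‖K z‖ * (prodWt z)⁻¹ := by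
  have h : Integrable fun z => 2 ^ (2 * d - 1) * (‖K z‖ + ‖z‖ ^ (2 * d) * ‖K z‖) :=
    (K.integrable.norm.add (K.integrable_pow_mul volume (2 * d))).const_mul _
  refine h.mono' (K.continuous.norm.mul (continuous_prodWt.inv₀ fun z =>
    (prodWt_pos z).ne')).aestronglyMeasurable (ae_of_all _ fun z => ?_)
  have h1 := (inv_prodWt_le z).trans (add_pow_le zero_le_one (norm_nonneg z) (2 * d))
  rw [Real.norm_of_nonneg (mul_nonneg (norm_nonneg _) (inv_nonneg.2 (prodWt_pos z).le))]
  calc _ ≤ ‖K z‖ * (2 ^ (2 * d - 1) * (1 ^ (2 * d) + ‖z‖ ^ (2 * d))) := by gcongr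
    _ = _ := by ring

/-- Cauchy–Schwarz for the measure k dμ, from the discriminant of the nonnegative quadratic t ↦ ∫ k
(t - f)². -/
lemma sq_integral_mul_le {α : Type*} [MeasurableSpace α] {μ : Measure α} {k f : α → ℝ}
    (hk : ∀ x, 0 ≤ k x) (h0 : Integrable k μ) (h1 : Integrable (fun x => k x * f x) μ)
    (h2 : Integrable (fun x => k x * f x ^ 2) μ) :
    (∫ x, k x * f x ∂μ) ^ 2 ≤ (∫ x, k x ∂μ) * ∫ x, k x * f x ^ 2 ∂μ := by
  have h : ∀ t : ℝ, 0 ≤ (∫ x, k x ∂μ) * (t * t) + (-2 * ∫ x, k x * f x ∂μ) * t +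
      ∫ x, k x * f x ^ 2 ∂μ := fun t => by
    have e : ∫ x, k x * (t - f x) ^ 2 ∂μ = (∫ x, k x ∂μ) * (t * t) +
        (-2 * ∫ x, k x * f x ∂μ) * t + ∫ x, k x * f x ^ 2 ∂μ := by
      have : ∀ x, k x * (t - f x) ^ 2 = k x * (t * t) + (k x * f x) * (-2 * t) + k x * f x ^ 2 :=
        fun x => by ring
      simp_rw [this]
      have h3 : Integrable (fun x => k x * (t * t) + k x * f x * (-2 * t)) μ :=
        (h0.mul_const _).add (h1.mul_const _)
      rw [integral_add h3 h2, integral_add (h0.mul_const _) (h1.mul_const _), integral_mul_const, integral_mul_const]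
      ring
    rw [← e]
    exact integral_nonneg fun x => mul_nonneg (hk x) (sq_nonneg _)
  have := discrim_le_zero h
  rw [discrim] at this
  linarith

section Convolution

variable {f : EuclideanSpace ℝ (Fin d) → ℂ}

lemma integrable_norm_kernel_mul_norm_sq (hf : Continuous f) (hf2 : Integrable fun z => ‖f z‖ ^ 2)
    (K : 𝓢(EuclideanSpace ℝ (Fin d), ℂ)) (y : EuclideanSpace ℝ (Fin d)) :
    Integrable fun z => ‖K (y - z)‖ * ‖f z‖ ^ 2 := by
  obtain ⟨B, hB, hK⟩ := K.exists_norm_le_prodWt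
  refine (hf2.const_mul B).mono' (Continuous.aestronglyMeasurable (by fun_prop))
    (ae_of_all _ fun z => ?_)
  rw [Real.norm_of_nonneg (by positivity)]
  gcongr
  exact (hK _).trans (mul_le_of_le_one_right hB (prodWt_le_one _))

lemma norm_sq_integral_kernel_mul_le (hf : Continuous f) (hf2 : Integrable fun z => ‖f z‖ ^ 2)
    (K : 𝓢(EuclideanSpace ℝ (Fin d), ℂ)) (y : EuclideanSpace ℝ (Fin d)) :
    ‖∫ z, K (y - z) * f z‖ ^ 2 ≤ (∫ z, ‖K z‖) * ∫ z, ‖K (y - z)‖ * ‖f z‖ ^ 2 := by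
  have h0 : Integrable fun z => ‖K (y - z)‖ := (K.integrable.comp_sub_left y).norm
  have h2 := integrable_norm_kernel_mul_norm_sq hf hf2 K y
  have h1 : Integrable fun z => ‖K (y - z)‖ * ‖f z‖ := by
    refine (h0.add h2).mono' (Continuous.aestronglyMeasurable (by fun_prop))
      (ae_of_all _ fun z => ?_)
    rw [Real.norm_of_nonneg (by positivity)]
    simp only [Pi.add_apply]
    -- Uses |f| ≤ |f|² + 1/4.
    nlinarith [mul_nonneg (norm_nonneg (K (y - z))) (sq_nonneg (‖f z‖ - 1 / 2)),
      norm_nonneg (K (y - z))]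
  have h := sq_integral_mul_le (fun z => norm_nonneg (K (y - z))) h0 h1 h2
  rw [integral_sub_left_eq_self (fun z => ‖K z‖) volume y] at h
  refine le_trans ?_ h
  gcongr
  refine (norm_integral_le_integral_norm _).trans_eq ?_
  simp_rw [norm_mul]

/-- Cauchy–Schwarz and Fubini leave the weight at y where it is wanted at z. The exchange costs
`(prodWt (y - z))⁻¹`, a polynomial factor which the Schwartz kernel integrates. -/
lemma integral_norm_sq_integral_kernel_mul_le (hf : Continuous f)
    (hf2 : Integrable fun z => ‖f z‖ ^ 2) (K : 𝓢(EuclideanSpace ℝ (Fin d), ℂ))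
    (x : EuclideanSpace ℝ (Fin d)) :
    ∫ y, ‖∫ z, K (y - z) * f z‖ ^ 2 * prodWt (y - x) ≤
      (∫ z, ‖K z‖) * (2 ^ d * ∫ z, ‖K z‖ * (prodWt z)⁻¹) *
        ∫ z, ‖f z‖ ^ 2 * prodWt (z - x) := by
  have hint : Integrable (fun p : EuclideanSpace ℝ (Fin d) × EuclideanSpace ℝ (Fin d) =>
      ‖K (p.1 - p.2)‖ * ‖f p.2‖ ^ 2 * prodWt (p.1 - x)) (volume.prod volume) := by
    have h := hf2.convolution_integrand (ContinuousLinearMap.mul ℝ ℝ)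
      (K.integrable (μ := volume)).norm
    refine h.mono' ?_ (ae_of_all _ fun p => ?_)
    · have := continuous_prodWt (d := d)
      exact Continuous.aestronglyMeasurable (by fun_prop)
    · have := prodWt_pos (p.1 - x)
      rw [Real.norm_of_nonneg (by positivity)]
      calc _ ≤ ‖K (p.1 - p.2)‖ * ‖f p.2‖ ^ 2 * 1 := by gcongr; exact prodWt_le_one _
        _ = _ := by simp [mul_comm]
  have hA : 0 ≤ ∫ z, ‖K z‖ := integral_nonneg fun _ => norm_nonneg _
  have hW : Integrable fun z => ‖f z‖ ^ 2 * prodWt (z - x) := by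
    refine hf2.mono' ?_ (ae_of_all _ fun z => ?_)
    · have := continuous_prodWt (d := d)
      exact Continuous.aestronglyMeasurable (by fun_prop)
    · have := prodWt_pos (z - x)
      rw [Real.norm_of_nonneg (by positivity)]
      exact mul_le_of_le_one_right (by positivity) (prodWt_le_one _)
  have hKW := K.integrable_norm_mul_inv_prodWt
  have step1 : ∫ y, ‖∫ z, K (y - z) * f z‖ ^ 2 * prodWt (y - x) ≤
      ∫ y, (∫ z, ‖K z‖) * ∫ z, ‖K (y - z)‖ * ‖f z‖ ^ 2 * prodWt (y - x) := by
    refine integral_mono_of_nonneg (ae_of_all _ fun y => ?_) (hint.integral_prod_left.const_mul _)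
      (ae_of_all _ fun y => ?_)
    · have := prodWt_pos (y - x)
      positivity
    · simp only
      rw [integral_mul_const, ← mul_assoc]
      exact mul_le_mul_of_nonneg_right (norm_sq_integral_kernel_mul_le hf hf2 K y)
        (prodWt_pos _).le
  refine step1.trans ?_
  rw [integral_const_mul, integral_integral_swap hint, mul_assoc (∫ z, ‖K z‖)]
  refine mul_le_mul_of_nonneg_left ?_ hA
  rw [← integral_const_mul]
  refine integral_mono hint.integral_prod_right (hW.const_mul _) fun z => ?_
  simp only
  have hle : ∀ y, ‖K (y - z)‖ * ‖f z‖ ^ 2 * prodWt (y - x) ≤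
      (‖f z‖ ^ 2 * prodWt (z - x) * 2 ^ d) * (‖K (y - z)‖ * (prodWt (y - z))⁻¹) := fun y => by
    have h := prodWt_add_le (z - x) (y - z)
    rw [show z - x + (y - z) = y - x by abel] at h
    calc _ ≤ ‖K (y - z)‖ * ‖f z‖ ^ 2 * (2 ^ d * (prodWt (y - z))⁻¹ * prodWt (z - x)) := by gcongr
      _ = _ := by ring
  calc _ ≤ ∫ y, (‖f z‖ ^ 2 * prodWt (z - x) * 2 ^ d) * (‖K (y - z)‖ * (prodWt (y - z))⁻¹) := by
        refine integral_mono_of_nonneg (ae_of_all _ fun y => ?_)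
          ((hKW.comp_sub_right z).const_mul _) (ae_of_all _ hle)
        have := prodWt_pos (y - x)
        positivity
    _ = _ := by
        rw [integral_const_mul,
          integral_sub_right_eq_self (fun y => ‖K y‖ * (prodWt y)⁻¹) z]
        ring

end Convolution

/-! ### Weighted multiplier bounds and pointwise bounds for band-limited waves -/

lemma exists_schwartzMap_eq_on_ball {b : EuclideanSpace ℝ (Fin d) → ℂ}
    (hb : ContDiff ℝ (⊤ : ℕ∞) b) :
    ∃ a : 𝓢(EuclideanSpace ℝ (Fin d), ℂ), ∀ ζ, ‖ζ‖ ≤ 1 → a ζ = b ζ := by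
  let φ : ContDiffBump (0 : EuclideanSpace ℝ (Fin d)) := ⟨1, 2, one_pos, one_lt_two⟩
  have hc : HasCompactSupport fun ζ => (φ ζ : ℂ) * b ζ :=
    HasCompactSupport.mul_right (φ.hasCompactSupport.comp_left (g := Complex.ofReal) rfl)
  have hs : ContDiff ℝ (⊤ : ℕ∞) fun ζ => (φ ζ : ℂ) * b ζ :=
    (Complex.ofRealCLM.contDiff.comp φ.contDiff).mul hb
  refine ⟨hc.toSchwartzMap hs, fun ζ hζ => ?_⟩
  have : φ ζ = 1 := φ.one_of_mem_closedBall (by simpa [φ] using hζ)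
  rw [HasCompactSupport.toSchwartzMap_toFun, this]
  simp

lemma BandLimited.mul_congr {G : EuclideanSpace ℝ (Fin d) → ℂ} (hG : BandLimited G)
    {a b : EuclideanSpace ℝ (Fin d) → ℂ} (h : ∀ ζ, ‖ζ‖ ≤ 1 → a ζ = b ζ) :
    (fun ζ => a ζ * G ζ) = fun ζ => b ζ * G ζ := by
  funext ζ
  by_cases hζ : 1 < ‖ζ‖
  · simp [hG.eq_zero ζ hζ]
  · rw [h ζ (not_lt.1 hζ)]

/-- On the unit ball the symbol may be replaced by a Schwartz function, so the multiplier is a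
convolution whose kernel depends neither on time nor on the wave. This is the uniform local control
of ∇u by u. -/
lemma exists_integral_wave_mul_le {b : EuclideanSpace ℝ (Fin d) → ℂ}
    (hb : ContDiff ℝ (⊤ : ℕ∞) b) :
    ∃ C, 0 ≤ C ∧ ∀ G, BandLimited G → ∀ s x,
      ∫ y, ‖wave (fun ζ => b ζ * G ζ) s y‖ ^ 2 * prodWt (y - x) ≤
        C * ∫ y, ‖wave G s y‖ ^ 2 * prodWt (y - x) := by
  obtain ⟨a, ha⟩ := exists_schwartzMap_eq_on_ball hb
  set K : 𝓢(EuclideanSpace ℝ (Fin d), ℂ) := 𝓕⁻ a with hK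
  have h1 : 0 ≤ ∫ z, ‖K z‖ := integral_nonneg fun _ => norm_nonneg _
  have h2 : 0 ≤ ∫ z, ‖K z‖ * (prodWt z)⁻¹ :=
    integral_nonneg fun z => mul_nonneg (norm_nonneg _) (inv_nonneg.2 (prodWt_pos z).le)
  refine ⟨(∫ z, ‖K z‖) * (2 ^ d * ∫ z, ‖K z‖ * (prodWt z)⁻¹), by positivity,
    fun G hG s x => ?_⟩
  rw [← hG.mul_congr ha]
  simp_rw [wave_mul_eq_integral hG]
  exact integral_norm_sq_integral_kernel_mul_le (continuous_wave_apply hG s)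
    (integrable_norm_sq_wave hG s) K x

lemma integrable_norm_sq_wave_mul_prodWt {G : EuclideanSpace ℝ (Fin d) → ℂ} (hG : BandLimited G)
    (s : ℝ) (x : EuclideanSpace ℝ (Fin d)) :
    Integrable fun z => ‖wave G s z‖ ^ 2 * prodWt (z - x) := by
  refine (integrable_norm_sq_wave hG s).mono' ?_ (ae_of_all _ fun z => ?_)
  · have := continuous_prodWt (d := d)
    have := continuous_wave_apply hG s
    exact Continuous.aestronglyMeasurable (by fun_prop)
  · have := prodWt_pos (z - x)
    rw [Real.norm_of_nonneg (by positivity)]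
    exact mul_le_of_le_one_right (by positivity) (prodWt_le_one _)

/-- The symbol 1, cut off outside the unit ball, gives a reproducing kernel: the wave equals its own
convolution with a Schwartz function, so its values are local averages. -/
lemma exists_norm_sq_wave_le (d : ℕ) (R : ℝ) :
    ∃ C, 0 ≤ C ∧ ∀ G : EuclideanSpace ℝ (Fin d) → ℂ, BandLimited G → ∀ s y x, ‖y - x‖ ≤ R →
      ‖wave G s y‖ ^ 2 ≤ C * ∫ z, ‖wave G s z‖ ^ 2 * prodWt (z - x) := by
  obtain ⟨a, ha⟩ := exists_schwartzMap_eq_on_ball (d := d) (b := fun _ => 1) contDiff_const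
  set K : 𝓢(EuclideanSpace ℝ (Fin d), ℂ) := 𝓕⁻ a with hK
  obtain ⟨B, hB, hKB⟩ := K.exists_norm_le_prodWt
  have hA : 0 ≤ ∫ z, ‖K z‖ := integral_nonneg fun _ => norm_nonneg _
  refine ⟨(∫ z, ‖K z‖) * (B * (2 ^ d * (1 + |R|) ^ (2 * d))), by positivity,
    fun G hG s y x hyx => ?_⟩
  have h1 : wave G s y = ∫ z, K (y - z) * wave G s z := by
    rw [hK, ← wave_mul_eq_integral hG a, hG.mul_congr ha]
    simp
  rw [h1]
  refine (norm_sq_integral_kernel_mul_le (continuous_wave_apply hG s)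
    (integrable_norm_sq_wave hG s) K y).trans ?_
  rw [mul_assoc]
  refine mul_le_mul_of_nonneg_left ?_ hA
  rw [← integral_const_mul]
  refine integral_mono (integrable_norm_kernel_mul_norm_sq (continuous_wave_apply hG s)
    (integrable_norm_sq_wave hG s) K y) ((integrable_norm_sq_wave_mul_prodWt hG s x).const_mul _)
    fun z => ?_
  have hsym : prodWt (y - z) = prodWt (z - y) := by
    unfold prodWt wt
    refine Finset.prod_congr rfl fun i _ => ?_
    simp only [PiLp.sub_apply]
    ring
  have h2 : prodWt (y - z) ≤ 2 ^ d * (1 + |R|) ^ (2 * d) * prodWt (z - x) := by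
    have h := prodWt_add_le (z - x) (x - y)
    rw [show z - x + (x - y) = z - y by abel] at h
    rw [hsym]
    refine h.trans (mul_le_mul_of_nonneg_right ?_ (prodWt_pos _).le)
    refine mul_le_mul_of_nonneg_left ((inv_prodWt_le _).trans ?_) (by positivity)
    gcongr
    rw [norm_sub_rev]
    exact hyx.trans (le_abs_self R)
  calc ‖K (y - z)‖ * ‖wave G s z‖ ^ 2 ≤
        (B * (2 ^ d * (1 + |R|) ^ (2 * d) * prodWt (z - x))) * ‖wave G s z‖ ^ 2 := by
        gcongr
        exact (hKB _).trans (by gcongr)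
    _ = _ := by ring

/-! ### Cell masses and fluxes -/

/-- Twice the imaginary part of `conj (wave A) * wave B`. -/
noncomputable def crossIm (A B : EuclideanSpace ℝ (Fin d) → ℂ) (s : ℝ)
    (y : EuclideanSpace ℝ (Fin d)) : ℝ :=
  2 * (starRingEnd ℂ (wave A s y) * wave B s y).im

/-- The amplitude of the partial derivative of a wave. -/
noncomputable def derivAmp (j : Fin d) (G : EuclideanSpace ℝ (Fin d) → ℂ)
    (ζ : EuclideanSpace ℝ (Fin d)) : ℂ :=
  Complex.I * (2 * Real.pi * ζ j : ℝ) * G ζ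

/-- The amplitude of minus the Laplacian of a wave. -/
noncomputable def negLaplAmp (G : EuclideanSpace ℝ (Fin d) → ℂ)
    (ζ : EuclideanSpace ℝ (Fin d)) : ℂ :=
  (4 * Real.pi ^ 2 * ‖ζ‖ ^ 2 : ℝ) * G ζ

/-- The mass of a wave in the cell centred at the lattice point `k`. -/
noncomputable def cellMass (G : EuclideanSpace ℝ (Fin d) → ℂ) (s : ℝ) (k : Fin d → ℤ) : ℝ :=
  ∫ y, ‖wave G s y‖ ^ 2 * prodBump (y - latticePt k)

/-- The flux of mass from the cell `k - e_j` to the cell `k`. -/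
noncomputable def flux (G : EuclideanSpace ℝ (Fin d) → ℂ) (j : Fin d) (s : ℝ) (k : Fin d → ℤ) : ℝ :=
  ∫ y, crossIm G (derivAmp j G) s y * faceWt j (y - latticePt k)

section

variable {A B G : EuclideanSpace ℝ (Fin d) → ℂ}

lemma BandLimited.derivAmp (hG : BandLimited G) (j : Fin d) : BandLimited (derivAmp j G) :=
  hG.mul (a := fun ζ => Complex.I * (2 * Real.pi * ζ j : ℝ)) (by fun_prop)

lemma BandLimited.negLaplAmp (hG : BandLimited G) : BandLimited (negLaplAmp G) :=
  hG.mul (a := fun ζ => ((4 * Real.pi ^ 2 * ‖ζ‖ ^ 2 : ℝ) : ℂ)) (by fun_prop)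

lemma abs_crossIm_le (A B : EuclideanSpace ℝ (Fin d) → ℂ) (s : ℝ)
    (y : EuclideanSpace ℝ (Fin d)) :
    |crossIm A B s y| ≤ ‖wave A s y‖ ^ 2 + ‖wave B s y‖ ^ 2 := by
  have h := Complex.abs_im_le_norm (starRingEnd ℂ (wave A s y) * wave B s y)
  rw [norm_mul, RCLike.norm_conj] at h
  rw [crossIm, abs_mul, abs_two]
  nlinarith [sq_nonneg (‖wave A s y‖ - ‖wave B s y‖)]

lemma continuous_crossIm (hA : BandLimited A) (hB : BandLimited B) :
    Continuous fun p : ℝ × EuclideanSpace ℝ (Fin d) => crossIm A B p.1 p.2 := by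
  have h1 := continuous_wave hA
  have h2 := continuous_wave hB
  unfold crossIm
  exact continuous_const.mul (Complex.continuous_im.comp ((Complex.continuous_conj.comp h1).mul h2))

lemma continuous_crossIm_apply (hA : BandLimited A) (hB : BandLimited B) (s : ℝ) :
    Continuous (crossIm A B s) := by
  have h := continuous_crossIm hA hB
  generalize crossIm A B = f at h ⊢
  exact h.comp (Continuous.prodMk_right s)

lemma abs_crossIm_mul_le {φ : EuclideanSpace ℝ (Fin d) → ℝ} {M : ℝ} (hM : ∀ y, |φ y| ≤ M)
    (s : ℝ) (y : EuclideanSpace ℝ (Fin d)) :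
    ‖crossIm A B s y * φ y‖ ≤ (‖wave A s y‖ ^ 2 + ‖wave B s y‖ ^ 2) * M := by
  rw [norm_mul]
  exact mul_le_mul (abs_crossIm_le A B s y) (hM y) (norm_nonneg _) (by positivity)

lemma integrable_crossIm_mul (hA : BandLimited A) (hB : BandLimited B)
    {φ : EuclideanSpace ℝ (Fin d) → ℝ} (hφ : Continuous φ) {M : ℝ} (hM : ∀ y, |φ y| ≤ M) (s : ℝ) :
    Integrable fun y => crossIm A B s y * φ y :=
  (((integrable_norm_sq_wave hA s).add (integrable_norm_sq_wave hB s)).mul_const M).mono'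
    ((continuous_crossIm_apply hA hB s).mul hφ).aestronglyMeasurable
    (ae_of_all _ fun y => abs_crossIm_mul_le hM s y)

lemma integral_norm_crossIm_mul_le (hA : BandLimited A) (hB : BandLimited B)
    {φ : EuclideanSpace ℝ (Fin d) → ℝ} {M : ℝ} (hM : ∀ y, |φ y| ≤ M) (s : ℝ) :
    ∫ y, ‖crossIm A B s y * φ y‖ ≤ ((∫ ζ, ‖A ζ‖ ^ 2) + ∫ ζ, ‖B ζ‖ ^ 2) * M := by
  rw [← integral_norm_sq_wave hA s, ← integral_norm_sq_wave hB s,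
    ← integral_add (integrable_norm_sq_wave hA s) (integrable_norm_sq_wave hB s),
    ← integral_mul_const]
  exact integral_mono_of_nonneg (ae_of_all _ fun _ => norm_nonneg _)
    (((integrable_norm_sq_wave hA s).add (integrable_norm_sq_wave hB s)).mul_const M)
    (ae_of_all _ fun y => abs_crossIm_mul_le hM s y)

/-- The equation reads ∂ₜu = -i(-Δu), and 2 Re(ū · (-i)w) = 2 Im(ū w). -/
lemma hasDerivAt_norm_sq_wave (hG : BandLimited G) (s : ℝ) (y : EuclideanSpace ℝ (Fin d)) :
    HasDerivAt (fun s => ‖wave G s y‖ ^ 2) (crossIm G (negLaplAmp G) s y) s := by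
  have h := (hasDerivAt_wave hG s y).norm_sq
  refine h.congr_deriv ?_
  have e : wave (fun ζ => -(Complex.I * (4 * Real.pi ^ 2 * ‖ζ‖ ^ 2 : ℝ)) * G ζ) s y =
      -(Complex.I * wave (negLaplAmp G) s y) := by
    unfold wave negLaplAmp
    rw [← integral_const_mul, ← integral_neg]
    refine integral_congr_ae (ae_of_all _ fun ζ => ?_)
    simp only
    ring
  rw [e, Complex.inner, crossIm]
  simp
  ring

lemma wave_negLaplAmp (hG : BandLimited G) (s : ℝ) (y : EuclideanSpace ℝ (Fin d)) :
    wave (negLaplAmp G) s y = -∑ j, wave (derivAmp j (derivAmp j G)) s y := by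
  unfold wave
  rw [← integral_finsetSum, ← integral_neg]
  · refine integral_congr_ae (ae_of_all _ fun ζ => ?_)
    simp only [negLaplAmp, derivAmp]
    rw [← Finset.mul_sum, ← mul_neg, EuclideanSpace.norm_sq_eq]
    congr 1
    simp only [Real.norm_eq_abs, sq_abs]
    push_cast
    rw [Finset.mul_sum, Finset.sum_mul, ← Finset.sum_neg_distrib]
    refine Finset.sum_congr rfl fun j _ => ?_
    linear_combination (4 * (Real.pi : ℂ) ^ 2 * (ζ j : ℂ) ^ 2 * G ζ) * Complex.I_sq
  · intro j _
    exact (((hG.derivAmp j).derivAmp j).mul (a := fun ζ => Complex.exp (Complex.I *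
      ((2 * Real.pi * inner ℝ y ζ - 4 * Real.pi ^ 2 * s * ‖ζ‖ ^ 2 : ℝ) : ℂ)))
      (by fun_prop)).integrable

lemma crossIm_negLaplAmp (hG : BandLimited G) (s : ℝ) (y : EuclideanSpace ℝ (Fin d)) :
    crossIm G (negLaplAmp G) s y = -∑ j, crossIm G (derivAmp j (derivAmp j G)) s y := by
  simp only [crossIm, wave_negLaplAmp hG, mul_neg, Complex.neg_im, Finset.mul_sum, Complex.im_sum]

/-- The other term of the product rule, the conjugate of ∂ⱼu times ∂ⱼu, is real and drops out. -/
lemma hasLineDerivAt_crossIm (hG : BandLimited G) (j : Fin d) (s : ℝ)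
    (y : EuclideanSpace ℝ (Fin d)) :
    HasLineDerivAt ℝ (crossIm G (derivAmp j G) s)
      (crossIm G (derivAmp j (derivAmp j G)) s y) y (EuclideanSpace.single j 1) := by
  have h1 : HasLineDerivAt ℝ (wave G s) (wave (derivAmp j G) s y) y (EuclideanSpace.single j 1) :=
    hasLineDerivAt_wave hG s y j
  have h2 : HasLineDerivAt ℝ (wave (derivAmp j G) s) (wave (derivAmp j (derivAmp j G)) s y) y
    (EuclideanSpace.single j 1) := hasLineDerivAt_wave (hG.derivAmp j) s y j
  unfold HasLineDerivAt at h1 h2 ⊢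
  have h3 := h1.star.mul h2
  have h4 : HasDerivAt (fun t : ℝ => Complex.imCLM _) _ 0 :=
    Complex.imCLM.hasFDerivAt.comp_hasDerivAt (0 : ℝ) h3
  refine (h4.const_mul 2).congr_deriv ?_
  simp [crossIm]
  ring

lemma abs_le_of_le_prodWt {φ : EuclideanSpace ℝ (Fin d) → ℝ} {x : EuclideanSpace ℝ (Fin d)}
    {M : ℝ} (hM : 0 ≤ M) (h0 : ∀ y, 0 ≤ φ y) (h : ∀ y, φ y ≤ M * prodWt y) (y) :
    |φ (y - x)| ≤ M := by
  rw [abs_of_nonneg (h0 _)]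
  exact (h _).trans (mul_le_of_le_one_right hM (prodWt_le_one _))

lemma abs_faceWt_le (j : Fin d) (x y : EuclideanSpace ℝ (Fin d)) :
    |faceWt j (y - x)| ≤ (5 / 2) ^ d :=
  abs_le_of_le_prodWt (by positivity) (faceWt_nonneg j) (faceWt_le j) y

lemma abs_prodBump_le (x y : EuclideanSpace ℝ (Fin d)) :
    |prodBump (y - x)| ≤ (5 / 2) ^ d :=
  abs_le_of_le_prodWt (by positivity) (fun y => (prodBump_pos y).le) prodBump_le_prodWt y

lemma latticePt_add_single (k : Fin d → ℤ) (j : Fin d) :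
    latticePt (k + Pi.single j 1) = latticePt k + EuclideanSpace.single j 1 := by
  ext i
  by_cases h : i = j
  · subst h; simp
  · simp [h]

/-- Integration by parts of the divergence of the current against the cell bump; by
`hasLineDerivAt_prodBump` the derivative falls into two face weights. -/
lemma integral_crossIm_mul_prodBump (hG : BandLimited G) (s : ℝ) (k : Fin d → ℤ) :
    ∫ y, crossIm G (negLaplAmp G) s y * prodBump (y - latticePt k) =
      ∑ j, (flux G j s k - flux G j s (k + Pi.single j 1)) := by
  have hψ : Continuous fun y : EuclideanSpace ℝ (Fin d) => prodBump (y - latticePt k) :=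
    continuous_prodBump.comp (by fun_prop)
  have hφ : ∀ (j : Fin d) (k : Fin d → ℤ),
      Continuous fun y : EuclideanSpace ℝ (Fin d) => faceWt j (y - latticePt k) := fun j k =>
    (continuous_faceWt j).comp (by fun_prop)
  simp_rw [crossIm_negLaplAmp hG, neg_mul, Finset.sum_mul]
  rw [integral_neg, integral_finsetSum _ fun j _ => integrable_crossIm_mul hG
    ((hG.derivAmp j).derivAmp j) hψ (abs_prodBump_le _) s, ← Finset.sum_neg_distrib]
  refine Finset.sum_congr rfl fun j _ => ?_
  have i1 := integrable_crossIm_mul hG (hG.derivAmp j) (hφ j k) (abs_faceWt_le j _) s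
  have i2 := integrable_crossIm_mul hG (hG.derivAmp j) (hφ j (k + Pi.single j 1))
    (abs_faceWt_le j _) s
  unfold flux
  rw [← integral_sub i1 i2]
  have hder : ∀ y, HasLineDerivAt ℝ (fun y => prodBump (y - latticePt k))
      (faceWt j (y - latticePt k) - faceWt j (y - latticePt (k + Pi.single j 1))) y
      (EuclideanSpace.single j 1) := fun y => by
    have h := hasLineDerivAt_prodBump j (y - latticePt k)
    rw [latticePt_add_single, ← sub_sub]
    unfold HasLineDerivAt at h ⊢
    refine h.congr_of_eventuallyEq (Filter.Eventually.of_forall fun t => ?_)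
    simp only
    congr 1
    abel
  have h := integral_bilinear_hasLineDerivAt_right_eq_neg_left_of_integrable
    (μ := (volume : Measure (EuclideanSpace ℝ (Fin d))))
    (f := crossIm G (derivAmp j G) s) (f' := crossIm G (derivAmp j (derivAmp j G)) s)
    (g := fun y => prodBump (y - latticePt k))
    (g' := fun y => faceWt j (y - latticePt k) - faceWt j (y - latticePt (k + Pi.single j 1)))
    (v := EuclideanSpace.single j 1) (B := ContinuousLinearMap.mul ℝ ℝ)
    (integrable_crossIm_mul hG ((hG.derivAmp j).derivAmp j) hψ (abs_prodBump_le _) s)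
    ((i1.sub i2).congr (ae_of_all _ fun y => by simp [mul_sub]))
    (integrable_crossIm_mul hG (hG.derivAmp j) hψ (abs_prodBump_le _) s)
    (fun y _ => hasLineDerivAt_crossIm hG j s y) (fun y _ => hder y)
  simp only [ContinuousLinearMap.mul_apply'] at h
  rw [← h]
  simp_rw [mul_sub]

lemma integrable_prod_crossIm_mul (hA : BandLimited A) (hB : BandLimited B)
    {φ : EuclideanSpace ℝ (Fin d) → ℝ} (hφ : Continuous φ) {M : ℝ} (hM : ∀ y, |φ y| ≤ M)
    (t₀ t₁ : ℝ) :
    Integrable (fun p : ℝ × EuclideanSpace ℝ (Fin d) => crossIm A B p.1 p.2 * φ p.2)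
      ((volume.restrict (Set.uIoc t₀ t₁)).prod volume) := by
  have hc : Continuous fun p : ℝ × EuclideanSpace ℝ (Fin d) => crossIm A B p.1 p.2 * φ p.2 :=
    (continuous_crossIm hA hB).mul (hφ.comp continuous_snd)
  have : IsFiniteMeasure (volume.restrict (Set.uIoc t₀ t₁)) :=
    ⟨by simp [Set.uIoc]⟩
  rw [integrable_prod_iff hc.aestronglyMeasurable]
  refine ⟨ae_of_all _ fun s => integrable_crossIm_mul hA hB hφ hM s, ?_⟩
  refine Integrable.of_bound (C := ((∫ ζ, ‖A ζ‖ ^ 2) + ∫ ζ, ‖B ζ‖ ^ 2) * M)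
    hc.aestronglyMeasurable.norm.integral_prod_right' (ae_of_all _ fun s => ?_)
  rw [Real.norm_of_nonneg (integral_nonneg fun _ => norm_nonneg _)]
  exact integral_norm_crossIm_mul_le hA hB hM s

lemma intervalIntegrable_flux (hG : BandLimited G) (j : Fin d) (k : Fin d → ℤ) (t₀ t₁ : ℝ) :
    IntervalIntegrable (fun s => flux G j s k) volume t₀ t₁ := by
  rw [intervalIntegrable_iff]
  exact (integrable_prod_crossIm_mul hG (hG.derivAmp j)
    ((continuous_faceWt j).comp (continuous_sub_right (latticePt k))) (abs_faceWt_le j _) t₀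
    t₁).integral_prod_left

lemma integrable_norm_sq_wave_mul_prodBump (hG : BandLimited G) (s : ℝ)
    (k : Fin d → ℤ) : Integrable fun y => ‖wave G s y‖ ^ 2 * prodBump (y - latticePt k) := by
  refine ((integrable_norm_sq_wave_mul_prodWt hG s (latticePt k)).const_mul ((5 / 2) ^ d)).mono'
    ?_ (ae_of_all _ fun y => ?_)
  · have := continuous_wave_apply hG s
    have := continuous_prodBump (d := d)
    exact Continuous.aestronglyMeasurable (by fun_prop)
  · have h := prodBump_pos (y - latticePt k)
    rw [Real.norm_of_nonneg (by positivity), mul_left_comm]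
    exact mul_le_mul_of_nonneg_left (prodBump_le_prodWt _) (by positivity)

/-- Conservation of mass, cell by cell. -/
lemma cellMass_sub_cellMass (hG : BandLimited G) (k : Fin d → ℤ) (t₀ t₁ : ℝ) :
    cellMass G t₁ k - cellMass G t₀ k =
      ∑ j, ((∫ s in t₀..t₁, flux G j s k) - ∫ s in t₀..t₁, flux G j s (k + Pi.single j 1)) := by
  have hψ : Continuous fun y : EuclideanSpace ℝ (Fin d) => prodBump (y - latticePt k) :=
    continuous_prodBump.comp (by fun_prop)
  have hint := integrable_prod_crossIm_mul hG hG.negLaplAmp hψ (abs_prodBump_le _) t₀ t₁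
  unfold cellMass
  rw [← integral_sub (integrable_norm_sq_wave_mul_prodBump hG t₁ k)
    (integrable_norm_sq_wave_mul_prodBump hG t₀ k)]
  -- The fundamental theorem of calculus is applied at each point, and Fubini follows, so the
  -- integral over the cell is never differentiated in time.
  have h1 : ∀ y, ‖wave G t₁ y‖ ^ 2 * prodBump (y - latticePt k) -
      ‖wave G t₀ y‖ ^ 2 * prodBump (y - latticePt k) =
      ∫ s in t₀..t₁, crossIm G (negLaplAmp G) s y * prodBump (y - latticePt k) := fun y => by
    rw [intervalIntegral.integral_mul_const, ← sub_mul]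
    congr 1
    refine (intervalIntegral.integral_eq_sub_of_hasDerivAt
      (fun s _ => hasDerivAt_norm_sq_wave hG s y) (Continuous.intervalIntegrable ?_ _ _)).symm
    have h := continuous_crossIm hG hG.negLaplAmp
    generalize crossIm G (negLaplAmp G) = f at h ⊢
    exact h.comp (Continuous.prodMk_left y)
  simp_rw [h1]
  rw [← intervalIntegral_integral_swap hint]
  simp_rw [integral_crossIm_mul_prodBump hG]
  rw [intervalIntegral.integral_finsetSum]
  · refine Finset.sum_congr rfl fun j _ => ?_
    exact intervalIntegral.integral_sub (intervalIntegrable_flux hG j k _ _)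
      (intervalIntegrable_flux hG j _ _ _)
  · exact fun j _ => (intervalIntegrable_flux hG j k _ _).sub (intervalIntegrable_flux hG j _ _ _)

end

lemma integral_norm_sq_wave_mul_prodWt_le {G : EuclideanSpace ℝ (Fin d) → ℂ}
    (hG : BandLimited G) (s : ℝ) (k : Fin d → ℤ) :
    ∫ y, ‖wave G s y‖ ^ 2 * prodWt (y - latticePt k) ≤ (5 / 2) ^ d * cellMass G s k := by
  rw [cellMass, ← integral_const_mul]
  refine integral_mono (integrable_norm_sq_wave_mul_prodWt hG s _)
    ((integrable_norm_sq_wave_mul_prodBump hG s k).const_mul _) fun y => ?_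
  simp only
  rw [mul_left_comm]
  exact mul_le_mul_of_nonneg_left (prodWt_le_prodBump _) (by positivity)

lemma cellMass_nonneg (G : EuclideanSpace ℝ (Fin d) → ℂ) (s : ℝ) (k : Fin d → ℤ) :
    0 ≤ cellMass G s k :=
  integral_nonneg fun _ => mul_nonneg (by positivity) (prodBump_pos _).le

lemma cellMass_le {G : EuclideanSpace ℝ (Fin d) → ℂ} (hG : BandLimited G) (s : ℝ)
    (k : Fin d → ℤ) : cellMass G s k ≤ (∫ ζ, ‖G ζ‖ ^ 2) * (5 / 2) ^ d := by
  rw [← integral_norm_sq_wave hG s, ← integral_mul_const]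
  refine integral_mono (integrable_norm_sq_wave_mul_prodBump hG s k)
    ((integrable_norm_sq_wave hG s).mul_const _) fun y => ?_
  exact mul_le_mul_of_nonneg_left ((le_abs_self _).trans (abs_prodBump_le _ _)) (by positivity)

lemma sum_cellMass_le {G : EuclideanSpace ℝ (Fin d) → ℂ} (hG : BandLimited G) (s : ℝ)
    (S : Finset (Fin d → ℤ)) :
    ∑ k ∈ S, cellMass G s k ≤ Real.pi ^ d * ∫ ζ, ‖G ζ‖ ^ 2 := by
  unfold cellMass
  rw [← integral_norm_sq_wave hG s, ← integral_const_mul,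
    ← integral_finsetSum _ fun k _ => integrable_norm_sq_wave_mul_prodBump hG s k]
  refine integral_mono
    (integrable_finsetSum _ fun k _ => integrable_norm_sq_wave_mul_prodBump hG s k)
    ((integrable_norm_sq_wave hG s).const_mul _) fun y => ?_
  simp only
  rw [← Finset.mul_sum, mul_comm]
  exact mul_le_mul_of_nonneg_right (sum_prodBump_le y S) (by positivity)

/-- The flux through each face of a cell is controlled by the mass of the cell. -/
lemma exists_abs_flux_le (d : ℕ) :
    ∃ c, 0 ≤ c ∧ ∀ G : EuclideanSpace ℝ (Fin d) → ℂ, BandLimited G → ∀ j s k,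
      |flux G j s k| ≤ c * cellMass G s k ∧
      |flux G j s (k + Pi.single j 1)| ≤ c * cellMass G s k := by
  have hb : ∀ j : Fin d, ContDiff ℝ (⊤ : ℕ∞)
      fun ζ : EuclideanSpace ℝ (Fin d) => Complex.I * (2 * Real.pi * ζ j : ℝ) := fun j => by
    have : ContDiff ℝ (⊤ : ℕ∞) fun ζ : EuclideanSpace ℝ (Fin d) => ((2 * Real.pi * ζ j : ℝ) : ℂ) :=
      Complex.ofRealCLM.contDiff.comp (contDiff_const.mul (contDiff_piLp_apply (p := 2)))
    exact contDiff_const.mul this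
  choose C hC0 hC using fun j => exists_integral_wave_mul_le (hb j)
  have hnn : 0 ≤ ∑ j, C j := Finset.sum_nonneg fun j _ => hC0 j
  -- One factor (5/2)^d bounds the face weight by `prodWt`, the other returns from `prodWt` to the
  -- cell bump; 1 + ∑ C comes from |J_j| ≤ |u|² + |∂ⱼu|².
  refine ⟨(5 / 2) ^ d * ((1 + ∑ j, C j) * (5 / 2) ^ d), by positivity, fun G hG j s k => ?_⟩
  have key : ∀ φ : EuclideanSpace ℝ (Fin d) → ℝ, (∀ y, 0 ≤ φ y) →
      (∀ y, φ y ≤ (5 / 2) ^ d * prodWt (y - latticePt k)) →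
      |∫ y, crossIm G (derivAmp j G) s y * φ y| ≤
        (5 / 2) ^ d * ((1 + ∑ j, C j) * (5 / 2) ^ d) * cellMass G s k := by
    intro φ h0 h
    have i1 := integrable_norm_sq_wave_mul_prodWt hG s (latticePt k)
    have i2 := integrable_norm_sq_wave_mul_prodWt (hG.derivAmp j) s (latticePt k)
    have hle : ∀ y, ‖crossIm G (derivAmp j G) s y * φ y‖ ≤ (5 / 2) ^ d *
        (‖wave G s y‖ ^ 2 * prodWt (y - latticePt k) +
          ‖wave (derivAmp j G) s y‖ ^ 2 * prodWt (y - latticePt k)) := fun y => by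
      rw [norm_mul, Real.norm_of_nonneg (h0 y), ← add_mul, mul_left_comm]
      exact mul_le_mul (abs_crossIm_le _ _ s y) (h y) (h0 y) (by positivity)
    have h1 := norm_integral_le_of_norm_le ((i1.add i2).const_mul ((5 / 2) ^ d))
      (ae_of_all volume hle)
    rw [← Real.norm_eq_abs]
    refine h1.trans ?_
    simp only [Pi.add_apply]
    rw [integral_const_mul, integral_add i1 i2, mul_assoc]
    refine mul_le_mul_of_nonneg_left ?_ (by positivity)
    rw [mul_assoc]
    have h2 : ∫ y, ‖wave (derivAmp j G) s y‖ ^ 2 * prodWt (y - latticePt k) ≤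
        (∑ j, C j) * ∫ y, ‖wave G s y‖ ^ 2 * prodWt (y - latticePt k) :=
      (hC j G hG s _).trans (mul_le_mul_of_nonneg_right
        (Finset.single_le_sum (fun j _ => hC0 j) (Finset.mem_univ j))
        (integral_nonneg fun _ => mul_nonneg (by positivity) (prodWt_pos _).le))
    calc _ ≤ (1 + ∑ j, C j) * ∫ y, ‖wave G s y‖ ^ 2 * prodWt (y - latticePt k) := by linarith
      _ ≤ _ := mul_le_mul_of_nonneg_left (integral_norm_sq_wave_mul_prodWt_le hG s k)
        (by positivity)
  refine ⟨key _ (fun y => faceWt_nonneg j _) fun y => faceWt_le j _,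
    key _ (fun y => faceWt_nonneg j _) fun y => ?_⟩
  rw [latticePt_add_single, ← sub_sub]
  exact faceWt_sub_single_le j _

/-- Over short time intervals the mass of a cell at most doubles, and the total flux through the
boundary of the cell is at most its initial mass. -/
lemma exists_time_step (d : ℕ) :
    ∃ τ, 0 < τ ∧ ∀ G : EuclideanSpace ℝ (Fin d) → ℂ, BandLimited G → ∀ t₀ k,
      (∀ t ∈ Set.Icc t₀ (t₀ + τ), cellMass G t k ≤ 2 * cellMass G t₀ k) ∧
      ∑ j, (|∫ s in t₀..t₀ + τ, flux G j s k| +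
        |∫ s in t₀..t₀ + τ, flux G j s (k + Pi.single j 1)|) ≤ cellMass G t₀ k := by
  obtain ⟨c, hc, hflux⟩ := exists_abs_flux_le d
  -- Chosen so that the 2d faces together carry at most a quarter of the supremal mass during one
  -- step.
  set τ : ℝ := 1 / (8 * (d + 1) * (c + 1)) with hτ
  have hτ0 : 0 < τ := by positivity
  have hτd : 2 * d * c * τ ≤ 1 / 4 := by
    rw [hτ, mul_one_div, div_le_iff₀ (by positivity)]
    have : (0 : ℝ) ≤ d := d.cast_nonneg
    nlinarith [mul_nonneg this hc]
  refine ⟨τ, hτ0, fun G hG t₀ k => ?_⟩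
  -- A bootstrap on the supremum, which is finite by `cellMass_le` and needs no continuity in time:
  -- sup ≤ m₀ + sup/4 gives sup ≤ 4m₀/3, and both conclusions follow.
  set I := (fun t => cellMass G t k) '' Set.Icc t₀ (t₀ + τ) with hI
  have hbdd : BddAbove I := ⟨_, by rintro _ ⟨t, -, rfl⟩; exact cellMass_le hG t k⟩
  have hne : I.Nonempty := ⟨_, t₀, ⟨le_rfl, by linarith⟩, rfl⟩
  have hle : ∀ t ∈ Set.Icc t₀ (t₀ + τ), cellMass G t k ≤ sSup I := fun t ht =>
    le_csSup hbdd ⟨t, ht, rfl⟩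
  have hA : 0 ≤ sSup I := (cellMass_nonneg G t₀ k).trans (hle t₀ ⟨le_rfl, by linarith⟩)
  have hsum : ∀ t ∈ Set.Icc t₀ (t₀ + τ), ∑ j, (|∫ s in t₀..t, flux G j s k| +
      |∫ s in t₀..t, flux G j s (k + Pi.single j 1)|) ≤ 1 / 4 * sSup I := by
    intro t ht
    have hI : ∀ f : ℝ → ℝ, (∀ s, |f s| ≤ c * cellMass G s k) →
        |∫ s in t₀..t, f s| ≤ c * sSup I * τ := fun f hf => by
      have h := intervalIntegral.norm_integral_le_of_norm_le_const (a := t₀) (b := t) (f := f)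
        (C := c * sSup I) fun s hs => by
          rw [Set.uIoc_of_le ht.1] at hs
          exact (hf s).trans (mul_le_mul_of_nonneg_left (hle s ⟨hs.1.le, hs.2.trans ht.2⟩) hc)
      refine h.trans (mul_le_mul_of_nonneg_left ?_ (by positivity))
      rw [abs_of_nonneg (by linarith [ht.1])]
      linarith [ht.2]
    calc _ ≤ ∑ _j : Fin d, (c * sSup I * τ + c * sSup I * τ) :=
          Finset.sum_le_sum fun j _ => add_le_add (hI _ fun s => (hflux G hG j s k).1)
            (hI _ fun s => (hflux G hG j s k).2)
      _ = 2 * d * c * τ * sSup I := by simp; ring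
      _ ≤ _ := mul_le_mul_of_nonneg_right hτd hA
  have hmass : ∀ t ∈ Set.Icc t₀ (t₀ + τ), cellMass G t k ≤ cellMass G t₀ k + 1 / 4 * sSup I := by
    intro t ht
    have h1 := cellMass_sub_cellMass hG k t₀ t
    have h2 : ∑ j, ((∫ s in t₀..t, flux G j s k) -
        ∫ s in t₀..t, flux G j s (k + Pi.single j 1)) ≤ 1 / 4 * sSup I := by
      refine (Finset.sum_le_sum fun j _ => ?_).trans (hsum t ht)
      rw [sub_eq_add_neg]
      exact add_le_add (le_abs_self _) (neg_le_abs _)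
    linarith
  have hsup : sSup I ≤ cellMass G t₀ k + 1 / 4 * sSup I :=
    csSup_le hne (by rintro _ ⟨t, ht, rfl⟩; exact hmass t ht)
  refine ⟨fun t ht => ?_, (hsum _ ⟨by linarith, le_rfl⟩).trans ?_⟩
  · linarith [hle t ht, cellMass_nonneg G t₀ k]
  · linarith [cellMass_nonneg G t₀ k]

/-! ### Superposition of lattice paths -/

-- A discrete superposition principle. At each step every path at `k` splits into one copy per move
-- `a`, with its weight divided in the proportions `K n k a / m n k`.
open scoped ENNReal in
lemma exists_paths_of_transition {S A : Type} [AddCommGroup S] [Countable S] [DecidableEq S]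
    [Fintype A] (step : A → S) (a₀ : A) (ha₀ : step a₀ = 0) (m : ℕ → S → ℝ≥0∞)
    (K : ℕ → S → A → ℝ≥0∞) (hm : ∀ n k, m n k ≠ ⊤) (hout : ∀ n k, ∑ a, K n k a = m n k)
    (hin : ∀ n k, ∑ a, K n (k - step a) a = m (n + 1) k) (N : ℕ) :
    ∃ (p : ℕ → ℕ → S) (w : ℕ → ℝ≥0∞), (∀ i n, ∃ a, p i (n + 1) = p i n + step a) ∧
      ∀ n ≤ N, ∀ k, ∑' i, (if p i n = k then w i else 0) = m n k := by
  induction N with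
  | zero =>
    -- The factor ℕ makes the index set infinite even for finite `S`; only the copy 0 carries
    -- weight.
    obtain ⟨e⟩ := nonempty_equiv_of_countable (α := ℕ) (β := S × ℕ)
    refine ⟨fun i _ => (e i).1, fun i => if (e i).2 = 0 then m 0 (e i).1 else 0,
      fun i n => ⟨a₀, by simp [ha₀]⟩, fun n hn k => ?_⟩
    rw [Nat.le_zero.1 hn,
      e.tsum_eq (fun q : S × ℕ => if q.1 = k then (if q.2 = 0 then m 0 q.1 else 0) else 0),
      ENNReal.tsum_prod', tsum_eq_single k fun b hb => by simp [hb]]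
    simp
  | succ N ih =>
    obtain ⟨p, w, hp, hw⟩ := ih
    have : Nonempty A := ⟨a₀⟩
    obtain ⟨e⟩ := nonempty_equiv_of_countable (α := ℕ) (β := ℕ × A)
    have hKm : ∀ k a, K N k a / m N k * m N k = K N k a := fun k a => by
      refine ENNReal.div_mul_cancel' (fun h0 => ?_) fun h => absurd h (hm _ _)
      have h := hout N k
      rw [h0, Finset.sum_eq_zero_iff] at h
      exact h a (Finset.mem_univ a)
    have hsplit : ∀ i, ∑ a, w i * (K N (p i N) a / m N (p i N)) = w i := fun i => by
      rw [← Finset.mul_sum]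
      simp_rw [div_eq_mul_inv]
      rw [← Finset.sum_mul, hout]
      -- In an empty cell the splitting proportions are meaningless, but every path there already
      -- has weight zero.
      by_cases h0 : m N (p i N) = 0
      · have h := hw N le_rfl (p i N)
        rw [h0, ENNReal.tsum_eq_zero] at h
        have := h i
        simp only [if_true] at this
        simp [this]
      · rw [ENNReal.mul_inv_cancel h0 (hm _ _), mul_one]
    refine ⟨fun i n => if n ≤ N then p (e i).1 n else p (e i).1 N + step (e i).2,
      fun i => w (e i).1 * (K N (p (e i).1 N) (e i).2 / m N (p (e i).1 N)), fun i n => ?_,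
      fun n hn k => ?_⟩
    · rcases lt_trichotomy n N with h | h | h
      · simp only [h.le, Nat.succ_le_of_lt h, if_true]
        exact hp _ _
      · subst h
        exact ⟨(e i).2, by simp⟩
      · refine ⟨a₀, ?_⟩
        simp only [if_neg (show ¬n + 1 ≤ N by omega), if_neg (show ¬n ≤ N by omega), ha₀, add_zero]
    · rw [e.tsum_eq (fun q : ℕ × A => if (if n ≤ N then p q.1 n else p q.1 N + step q.2) = k then
        w q.1 * (K N (p q.1 N) q.2 / m N (p q.1 N)) else 0), ENNReal.tsum_prod']
      simp_rw [tsum_fintype]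
      rcases Nat.lt_or_ge N n with h | h
      · obtain rfl : n = N + 1 := by omega
        simp only [not_le.2 h, if_false]
        rw [Summable.tsum_finsetSum fun _ _ => ENNReal.summable, ← hin N k]
        refine Finset.sum_congr rfl fun a _ => ?_
        rw [← hKm (k - step a) a, ← hw N le_rfl (k - step a), ← ENNReal.tsum_mul_left]
        refine tsum_congr fun i => ?_
        by_cases hi : p i N = k - step a
        · rw [if_pos hi, if_pos (by rw [hi, sub_add_cancel]), hw N le_rfl, hi, mul_comm]
        · rw [if_neg hi, if_neg fun h => hi (eq_sub_of_add_eq h), mul_zero]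
      · simp only [h, if_true]
        rw [← hw n h k]
        refine tsum_congr fun i => ?_
        split_ifs
        · exact hsplit i
        · simp

/-! ### Differentiable interpolation of discrete paths -/

lemma deriv_smoothTransition_of_nonpos {x : ℝ} (hx : x ≤ 0) : deriv Real.smoothTransition x = 0 := by
  have h : IsLocalMin Real.smoothTransition x := Filter.Eventually.of_forall fun y => by
    rw [Real.smoothTransition.zero_of_nonpos hx]
    exact Real.smoothTransition.nonneg y
  exact h.deriv_eq_zero

lemma deriv_smoothTransition_of_one_le {x : ℝ} (hx : 1 ≤ x) : deriv Real.smoothTransition x = 0 := by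
  have h : IsLocalMax Real.smoothTransition x := Filter.Eventually.of_forall fun y => by
    rw [Real.smoothTransition.one_of_one_le hx]
    exact Real.smoothTransition.le_one y
  exact h.deriv_eq_zero

lemma exists_abs_deriv_smoothTransition_le : ∃ B, 0 < B ∧ ∀ x, |deriv Real.smoothTransition x| ≤ B := by
  have hc : Continuous (deriv Real.smoothTransition) :=
    (Real.smoothTransition.contDiff (n := 1)).continuous_deriv le_rfl
  obtain ⟨B, hB⟩ := (isCompact_Icc (a := (0 : ℝ)) (b := 1)).exists_bound_of_continuousOn hc.continuousOn
  refine ⟨|B| + 1, by positivity, fun x => ?_⟩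
  by_cases h0 : x ≤ 0
  · rw [deriv_smoothTransition_of_nonpos h0, abs_zero]; positivity
  by_cases h1 : 1 ≤ x
  · rw [deriv_smoothTransition_of_one_le h1, abs_zero]; positivity
  · have := hB x ⟨(not_le.1 h0).le, (not_le.1 h1).le⟩
    rw [Real.norm_eq_abs] at this
    linarith [le_abs_self B]

/-- A smooth path through the points `p 0, …, p N` at the times `0, …, N`. -/
noncomputable def interpPath {E : Type*} [AddCommGroup E] [Module ℝ E] (p : ℕ → E) (N : ℕ) (x : ℝ) :
    E :=
  p 0 + ∑ n ∈ Finset.range N, Real.smoothTransition (x - n) • (p (n + 1) - p n)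

section Interp

variable {E : Type*} [NormedAddCommGroup E] [NormedSpace ℝ E] {p : ℕ → E}

lemma hasDerivAt_interpPath (p : ℕ → E) (N : ℕ) (x : ℝ) :
    HasDerivAt (interpPath p N) (∑ n ∈ Finset.range N,
      deriv Real.smoothTransition (x - n) • (p (n + 1) - p n)) x := by
  unfold interpPath
  refine HasDerivAt.const_add _ (HasDerivAt.fun_sum fun n _ => HasDerivAt.smul_const ?_ _)
  have h : HasDerivAt Real.smoothTransition (deriv Real.smoothTransition (x - n)) (x - n) :=
    ((Real.smoothTransition.contDiff (n := 1)).differentiable one_ne_zero _).hasDerivAt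
  exact h.comp_sub_const x n

/-- The supports of the derivatives of the transitions overlap at most at endpoints, where they
vanish, so at most one summand is nonzero. -/
lemma norm_deriv_interpPath_le (hp : ∀ n, ‖p (n + 1) - p n‖ ≤ 1) {B : ℝ}
    (hB : ∀ x, |deriv Real.smoothTransition x| ≤ B) (N : ℕ) (x : ℝ) :
    ‖∑ n ∈ Finset.range N, deriv Real.smoothTransition (x - n) • (p (n + 1) - p n)‖ ≤ B := by
  have hB0 : 0 ≤ B := (abs_nonneg _).trans (hB 0)
  by_cases h : ∃ n ∈ Finset.range N, deriv Real.smoothTransition (x - n) ≠ 0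
  · obtain ⟨n, hn, h⟩ := h
    have hn0 : 0 < x - n := by
      by_contra hc
      exact h (deriv_smoothTransition_of_nonpos (not_lt.1 hc))
    have hn1 : x - n < 1 := by
      by_contra hc
      exact h (deriv_smoothTransition_of_one_le (not_lt.1 hc))
    rw [Finset.sum_eq_single_of_mem n hn fun m _ hmn => ?_]
    · rw [norm_smul]
      exact (mul_le_mul (hB _) (hp n) (norm_nonneg _) hB0).trans_eq (mul_one B)
    · rcases lt_or_gt_of_ne hmn with hl | hl
      · have : (m : ℝ) + 1 ≤ n := by exact_mod_cast hl
        rw [deriv_smoothTransition_of_one_le (by linarith), zero_smul]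
      · have : (n : ℝ) + 1 ≤ m := by exact_mod_cast hl
        rw [deriv_smoothTransition_of_nonpos (by linarith), zero_smul]
  · push Not at h
    rw [Finset.sum_eq_zero fun n hn => by rw [h n hn, zero_smul], norm_zero]
    exact hB0

lemma norm_interpPath_sub_le (hp : ∀ n, ‖p (n + 1) - p n‖ ≤ 1) {n N : ℕ} (hn : n < N) {x : ℝ}
    (h0 : (n : ℝ) ≤ x) (h1 : x ≤ n + 1) : ‖interpPath p N x - p n‖ ≤ 1 := by
  have e : interpPath p N x = p n + Real.smoothTransition (x - n) • (p (n + 1) - p n) := by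
    rw [interpPath, ← Finset.sum_subset (Finset.range_subset_range.2 (Nat.succ_le_of_lt hn))
      fun m _ hm => ?_]
    · rw [Finset.sum_range_succ, Finset.sum_congr rfl fun m hm => ?_, Finset.sum_range_sub p]
      · abel
      · have : (m : ℝ) + 1 ≤ n := by exact_mod_cast Finset.mem_range.1 hm
        rw [Real.smoothTransition.one_of_one_le (by linarith), one_smul]
    · have : (n : ℝ) + 1 ≤ m := by
        rw [Finset.mem_range] at hm
        exact_mod_cast not_lt.1 hm
      rw [Real.smoothTransition.zero_of_nonpos (by linarith), zero_smul]
  rw [e, add_sub_cancel_left, norm_smul, Real.norm_of_nonneg (Real.smoothTransition.nonneg _)]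
  exact mul_le_one₀ (Real.smoothTransition.le_one _) (norm_nonneg _) (hp n)

end Interp

/-! ### The tube decomposition at unit frequency scale -/

/-- The lattice displacement of a move: stay, or move to a neighbour. -/
def moveStep : Option (Fin d × Bool) → (Fin d → ℤ)
  | none => 0
  | some (j, true) => Pi.single j 1
  | some (j, false) => -Pi.single j 1

lemma norm_latticePt_moveStep_le (a : Option (Fin d × Bool)) :
    ‖latticePt (moveStep a)‖ ≤ 1 := by
  have h : ∀ j : Fin d, latticePt (Pi.single j 1 : Fin d → ℤ) = EuclideanSpace.single j 1 := fun j => by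
    have := latticePt_add_single 0 j
    rw [zero_add] at this
    rw [this]
    ext i
    simp
  have hneg : ∀ k : Fin d → ℤ, latticePt (-k) = -latticePt k := fun k => by
    ext i; simp
  match a with
  | none =>
    have : latticePt (0 : Fin d → ℤ) = 0 := by ext i; simp
    simp [moveStep, this]
  | some (j, true) => simp [moveStep, h]
  | some (j, false) => simp [moveStep, h, hneg]

lemma latticePt_add (k l : Fin d → ℤ) : latticePt (k + l) = latticePt k + latticePt l := by
  ext i; simp

/-- The mass moved from the cell `k` by the move `a`, given the mass `M` of the cell and the
fluxes `Φ j k` from `k - e_j` to `k`. -/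
noncomputable def moveMass (M : (Fin d → ℤ) → ℝ) (Φ : Fin d → (Fin d → ℤ) → ℝ) (k : Fin d → ℤ) :
    Option (Fin d × Bool) → ℝ
  | none => M k - ∑ j, (max (Φ j (k + Pi.single j 1)) 0 + max (-Φ j k) 0)
  | some (j, true) => max (Φ j (k + Pi.single j 1)) 0
  | some (j, false) => max (-Φ j k) 0

lemma moveMass_nonneg {M : (Fin d → ℤ) → ℝ} {Φ : Fin d → (Fin d → ℤ) → ℝ}
    (h : ∀ k, ∑ j, (|Φ j k| + |Φ j (k + Pi.single j 1)|) ≤ M k) (k : Fin d → ℤ)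
    (a : Option (Fin d × Bool)) : 0 ≤ moveMass M Φ k a := by
  match a with
  | none =>
    refine sub_nonneg.2 (le_trans (Finset.sum_le_sum fun j _ => ?_) (h k))
    rw [add_comm]
    exact add_le_add (max_le (neg_le_abs _) (abs_nonneg _)) (max_le (le_abs_self _) (abs_nonneg _))
  | some (j, true) => exact le_max_right _ _
  | some (j, false) => exact le_max_right _ _

lemma sum_moveMass (M : (Fin d → ℤ) → ℝ) (Φ : Fin d → (Fin d → ℤ) → ℝ) (k : Fin d → ℤ) :
    ∑ a, moveMass M Φ k a = M k := by
  rw [Fintype.sum_option, Fintype.sum_prod_type]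
  simp [moveMass]

/-- Arrivals at `k` are the mass that stays, Φ⁺ through each lower face and Φ⁻ through each upper
face. Since Φ⁺ - Φ⁻ = Φ, the balance is the net flux. -/
lemma sum_moveMass_sub (M : (Fin d → ℤ) → ℝ) (Φ : Fin d → (Fin d → ℤ) → ℝ) (k : Fin d → ℤ) :
    ∑ a, moveMass M Φ (k - moveStep a) a = M k + ∑ j, (Φ j k - Φ j (k + Pi.single j 1)) := by
  rw [Fintype.sum_option, Fintype.sum_prod_type]
  simp only [moveMass, moveStep, Fintype.sum_bool, sub_zero, sub_add_cancel, sub_neg_eq_add]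
  rw [sub_add, ← Finset.sum_sub_distrib, sub_eq_add_neg, ← Finset.sum_neg_distrib]
  congr 1
  refine Finset.sum_congr rfl fun j _ => ?_
  have h1 := max_zero_sub_max_neg_zero_eq_self (Φ j k)
  have h2 := max_zero_sub_max_neg_zero_eq_self (Φ j (k + Pi.single j 1))
  linarith

lemma exists_norm_sub_latticePt_le (x : EuclideanSpace ℝ (Fin d)) :
    ∃ k : Fin d → ℤ, ‖x - latticePt k‖ ≤ d + 1 := by
  refine ⟨fun i => round (x i), abs_le_of_sq_le_sq' ?_ (by positivity) |>.2⟩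
  rw [EuclideanSpace.norm_sq_eq]
  calc ∑ i, ‖(x - latticePt fun i => round (x i)) i‖ ^ 2 ≤ ∑ _i : Fin d, (1 : ℝ) := by
        refine Finset.sum_le_sum fun i _ => pow_le_one₀ (norm_nonneg _) ?_
        have := abs_sub_round (x i)
        simp only [PiLp.sub_apply, latticePt_apply, Real.norm_eq_abs]
        linarith
    _ ≤ _ := by
        have : (0 : ℝ) ≤ d := d.cast_nonneg
        simp
        nlinarith

open scoped ENNReal in
/-- The masses of the cells at the times `t₀ + n τ`, `n ≤ N`, are superpositions of lattice
paths. -/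
lemma exists_lattice_paths {G : EuclideanSpace ℝ (Fin d) → ℂ} (hG : BandLimited G) {τ : ℝ}
    (h : ∀ t₀ k, ∑ j, (|∫ s in t₀..t₀ + τ, flux G j s k| +
        |∫ s in t₀..t₀ + τ, flux G j s (k + Pi.single j 1)|) ≤ cellMass G t₀ k)
    (t₀ : ℝ) (N : ℕ) :
    ∃ (p : ℕ → ℕ → Fin d → ℤ) (w : ℕ → ℝ≥0∞),
      (∀ i n, ‖latticePt (p i (n + 1)) - latticePt (p i n)‖ ≤ 1) ∧
      ∀ n ≤ N, ∀ k, ∑' i, (if p i n = k then w i else 0) =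
        ENNReal.ofReal (cellMass G (t₀ + n * τ) k) := by
  have hnn := fun n : ℕ => moveMass_nonneg (h (t₀ + n * τ))
  obtain ⟨p, w, hp, hw⟩ := exists_paths_of_transition (moveStep (d := d)) none rfl
    (fun n k => ENNReal.ofReal (cellMass G (t₀ + n * τ) k))
    (fun n k a => ENNReal.ofReal (moveMass (cellMass G (t₀ + n * τ))
      (fun j k => ∫ s in (t₀ + n * τ)..(t₀ + n * τ) + τ, flux G j s k) k a))
    (fun _ _ => ENNReal.ofReal_ne_top)
    (fun n k => by rw [← ENNReal.ofReal_sum_of_nonneg fun a _ => hnn n k a, sum_moveMass])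
    (fun n k => by
      rw [← ENNReal.ofReal_sum_of_nonneg fun a _ => hnn n _ a, sum_moveMass_sub,
        ← cellMass_sub_cellMass hG, add_sub_cancel]
      push_cast
      congr 2
      ring) N
  refine ⟨p, w, fun i n => ?_, hw⟩
  obtain ⟨a, ha⟩ := hp i n
  rw [ha, latticePt_add, add_sub_cancel_left]
  exact norm_latticePt_moveStep_le a

/-- Tube decomposition of waves with frequencies in the unit ball. -/
theorem exists_tubes_wave (d : ℕ) :
    ∃ r V C : ℝ, 0 < r ∧ 0 < V ∧ 0 < C ∧
      ∀ G : EuclideanSpace ℝ (Fin d) → ℂ, BandLimited G → ∀ T : ℝ, 0 < T →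
        ∃ (γ : ℕ → ℝ → EuclideanSpace ℝ (Fin d)) (w : ℕ → ℝ),
          (∀ i, Differentiable ℝ (γ i)) ∧ (∀ i t, ‖deriv (γ i) t‖ < V) ∧ (∀ i, 0 ≤ w i) ∧
          Summable w ∧
          (∀ (x : EuclideanSpace ℝ (Fin d)) (t : ℝ), t ∈ Set.Icc (-T) T →
            ‖wave G t x‖ ^ 2 ≤ ∑' i, w i * (tube (γ i) r).indicator (fun _ => (1 : ℝ)) (x, t)) ∧
          ∑' i, w i ≤ C * ∫ ζ, ‖G ζ‖ ^ 2 := by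
  obtain ⟨τ, hτ, hstep⟩ := exists_time_step d
  obtain ⟨C₁, hC₁, hpt⟩ := exists_norm_sq_wave_le d (d + 1)
  obtain ⟨B, hB0, hB⟩ := exists_abs_deriv_smoothTransition_le
  -- C₁ is the pointwise bound, (5/2)^d passes from `prodWt` to the cell mass, and 2 is the growth
  -- within one time step.
  set C₂ : ℝ := C₁ * ((5 / 2) ^ d * 2) with hC₂
  have hC₂0 : 0 ≤ C₂ := by positivity
  -- The radius is d + 1 from the point to its lattice point plus 1 from there to the path. The
  -- added 1's make the speed bound strict and the last constant positive.
  refine ⟨d + 2, B / τ + 1, C₂ * Real.pi ^ d + 1, by positivity, by positivity,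
    by have := Real.pi_pos; positivity, fun G hG T hT => ?_⟩
  obtain ⟨N, hN⟩ := exists_nat_gt (2 * T / τ)
  obtain ⟨p, w, hp, hw⟩ := exists_lattice_paths hG (fun t₀ k => (hstep G hG t₀ k).2) (-T) N
  have hI : 0 ≤ ∫ ζ, ‖G ζ‖ ^ 2 := integral_nonneg fun _ => by positivity
  have hsum : ∑' i, w i ≤ ENNReal.ofReal (Real.pi ^ d * ∫ ζ, ‖G ζ‖ ^ 2) := by
    -- Each path starts in exactly one cell, so the total weight is the total cell mass at time -T.
    have h1 : ∀ i, w i = ∑' k, if p i 0 = k then w i else 0 := fun i => by simp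
    calc ∑' i, w i = ∑' i, ∑' k, if p i 0 = k then w i else 0 := tsum_congr h1
      _ = ∑' k, ENNReal.ofReal (cellMass G (-T + (0 : ℕ) * τ) k) := by
        rw [ENNReal.tsum_comm]
        exact tsum_congr fun k => hw 0 (Nat.zero_le N) k
      _ ≤ _ := by
        rw [ENNReal.tsum_eq_iSup_sum]
        refine iSup_le fun S => ?_
        rw [← ENNReal.ofReal_sum_of_nonneg fun k _ => cellMass_nonneg _ _ _]
        exact ENNReal.ofReal_le_ofReal (sum_cellMass_le hG _ S)
  have hfin : ∑' i, w i ≠ ⊤ := ne_top_of_le_ne_top ENNReal.ofReal_ne_top hsum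
  have hwi : ∀ i, w i ≠ ⊤ := ENNReal.ne_top_of_tsum_ne_top hfin
  have hws : Summable fun i => (w i).toReal := ENNReal.summable_toReal hfin
  refine ⟨fun i t => interpPath (fun n => latticePt (p i n)) N ((t + T) * τ⁻¹),
    fun i => C₂ * (w i).toReal, ?_, ?_, fun i => by positivity, hws.mul_left _, ?_, ?_⟩
  rotate_left 2
  · intro x t ht
    set n := ⌊(t + T) * τ⁻¹⌋₊ with hn
    have hx0 : 0 ≤ (t + T) * τ⁻¹ := mul_nonneg (by linarith [ht.1]) (by positivity)
    have hn0 : (n : ℝ) ≤ (t + T) * τ⁻¹ := Nat.floor_le hx0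
    have hn1 : (t + T) * τ⁻¹ < n + 1 := Nat.lt_floor_add_one _
    have hnN : n < N := by
      have : (n : ℝ) < N := by
        refine hn0.trans_lt (lt_of_le_of_lt ?_ hN)
        rw [div_eq_mul_inv]
        exact mul_le_mul_of_nonneg_right (by linarith [ht.2]) (by positivity)
      exact_mod_cast this
    have htn : t ∈ Set.Icc (-T + n * τ) (-T + n * τ + τ) := by
      rw [← div_eq_mul_inv] at hn0 hn1
      rw [le_div_iff₀ hτ] at hn0
      rw [div_lt_iff₀ hτ] at hn1
      constructor <;> linarith
    obtain ⟨k, hk⟩ := exists_norm_sub_latticePt_le x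
    have h1 : ‖wave G t x‖ ^ 2 ≤ C₂ * cellMass G (-T + n * τ) k := by
      calc ‖wave G t x‖ ^ 2 ≤ C₁ * ∫ z, ‖wave G t z‖ ^ 2 * prodWt (z - latticePt k) :=
            hpt G hG t x _ hk
        _ ≤ C₁ * ((5 / 2) ^ d * (2 * cellMass G (-T + n * τ) k)) := by
            refine mul_le_mul_of_nonneg_left
              ((integral_norm_sq_wave_mul_prodWt_le hG t k).trans ?_) hC₁
            exact mul_le_mul_of_nonneg_left ((hstep G hG _ k).1 t htn) (by positivity)
        _ = _ := by rw [hC₂]; ring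
    have h2 : cellMass G (-T + n * τ) k = ∑' i, if p i n = k then (w i).toReal else 0 := by
      have h := congrArg ENNReal.toReal (hw n hnN.le k)
      rw [ENNReal.toReal_ofReal (cellMass_nonneg _ _ _), ENNReal.tsum_toReal_eq fun i => by
        split_ifs <;> simp [hwi]] at h
      rw [← h]
      refine tsum_congr fun i => ?_
      split_ifs <;> simp
    rw [h2, ← tsum_mul_left] at h1
    refine h1.trans (Summable.tsum_le_tsum (fun i => ?_) ?_ ?_)
    · split_ifs with hi
      · have hmem : (x, t) ∈ tube (fun t => interpPath (fun n => latticePt (p i n)) N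
            ((t + T) * τ⁻¹)) (d + 2) := by
          have h3 := norm_interpPath_sub_le (p := fun n => latticePt (p i n)) (hp i) hnN hn0 hn1.le
          simp only [hi] at h3
          simp only [tube, Set.mem_ofPred_eq]
          have h4 := norm_sub_le_norm_sub_add_norm_sub x (latticePt k)
            (interpPath (fun n => latticePt (p i n)) N ((t + T) * τ⁻¹))
          rw [norm_sub_rev (latticePt k)] at h4
          linarith
        rw [Set.indicator_of_mem hmem, mul_one]
      · rw [mul_zero]
        exact mul_nonneg (by positivity) (Set.indicator_nonneg (fun _ _ => zero_le_one) _)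
    · refine Summable.of_nonneg_of_le (fun i => ?_) (fun i => ?_) (hws.mul_left C₂)
      · split_ifs <;> positivity
      · split_ifs
        · exact le_rfl
        · rw [mul_zero]; positivity
    · refine Summable.of_nonneg_of_le (fun i => ?_) (fun i => ?_) (hws.mul_left C₂)
      · exact mul_nonneg (by positivity) (Set.indicator_nonneg (fun _ _ => zero_le_one) _)
      · exact mul_le_of_le_one_right (by positivity)
          (Set.indicator_le_self' (fun _ _ => zero_le_one) _ |>.trans le_rfl)
  · rw [tsum_mul_left, ← ENNReal.tsum_toReal_eq hwi]
    have h1 : (∑' i, w i).toReal ≤ Real.pi ^ d * ∫ ζ, ‖G ζ‖ ^ 2 :=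
      ENNReal.toReal_le_of_le_ofReal (mul_nonneg (pow_nonneg Real.pi_pos.le d) hI) hsum
    calc _ ≤ C₂ * (Real.pi ^ d * ∫ ζ, ‖G ζ‖ ^ 2) := mul_le_mul_of_nonneg_left h1 hC₂0
      _ ≤ _ := by linarith
  all_goals
    have hder : ∀ i t, HasDerivAt
      (fun t => interpPath (fun n => latticePt (p i n)) N ((t + T) * τ⁻¹)) (τ⁻¹ •
        ∑ n ∈ Finset.range N, deriv Real.smoothTransition ((t + T) * τ⁻¹ - n) •
          (latticePt (p i (n + 1)) - latticePt (p i n))) t := fun i t => by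
      have h1 : HasDerivAt (fun t : ℝ => (t + T) * τ⁻¹) τ⁻¹ t := by
        simpa using ((hasDerivAt_id t).add_const T).mul_const τ⁻¹
      exact (hasDerivAt_interpPath (fun n => latticePt (p i n)) N ((t + T) * τ⁻¹)).scomp t h1
  · exact fun i t => (hder i t).differentiableAt
  · intro i t
    rw [(hder i t).deriv, norm_smul, Real.norm_of_nonneg (by positivity)]
    have := norm_deriv_interpPath_le (p := fun n => latticePt (p i n)) (hp i) hB N ((t + T) * τ⁻¹)
    calc _ ≤ τ⁻¹ * B := mul_le_mul_of_nonneg_left this (by positivity)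
      _ < B / τ + 1 := by rw [div_eq_mul_inv, mul_comm]; linarith

/-! ### The solution formula on the frequency side -/

lemma SchwartzMap.exists_laplacian_fourier_eq (f : 𝓢(EuclideanSpace ℝ (Fin d), ℂ)) :
    ∃ g : 𝓢(EuclideanSpace ℝ (Fin d), ℂ), Δ (𝓕 f) = 𝓕 g ∧
      ∀ x, g x = -((4 * Real.pi ^ 2 * ‖x‖ ^ 2 : ℝ) : ℂ) * f x := by
  let b := EuclideanSpace.basisFun (Fin d) ℝ
  let M : Fin d → 𝓢(EuclideanSpace ℝ (Fin d), ℂ) → 𝓢(EuclideanSpace ℝ (Fin d), ℂ) := fun i f =>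
    -(2 * Real.pi * Complex.I) • SchwartzMap.smulLeftCLM ℂ (inner ℝ · (b i)) f
  have hM : ∀ i f x, M i f x = -(2 * Real.pi * Complex.I) * (x i : ℂ) * f x := fun i f x => by
    have : (fun x : EuclideanSpace ℝ (Fin d) => inner ℝ x (b i)).HasTemperateGrowth := by fun_prop
    simp only [M, _root_.smul_apply, SchwartzMap.smulLeftCLM_apply_apply this]
    simp [b, EuclideanSpace.inner_single_right]
    ring
  refine ⟨∑ i, M i (M i f), ?_, fun x => ?_⟩
  · rw [SchwartzMap.laplacian_eq_sum b]
    have h : ∀ i, LineDeriv.lineDerivOp (b i) (LineDeriv.lineDerivOp (b i) (𝓕 f)) =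
        𝓕 (M i (M i f)) := fun i => by
      rw [SchwartzMap.lineDerivOp_fourier_eq, SchwartzMap.lineDerivOp_fourier_eq]
    simp_rw [h]
    exact (map_sum (FourierTransform.fourierCLM ℂ 𝓢(EuclideanSpace ℝ (Fin d), ℂ)) _ _).symm
  · rw [_root_.sum_apply]
    simp_rw [hM]
    rw [EuclideanSpace.norm_sq_eq]
    simp only [Real.norm_eq_abs, sq_abs]
    push_cast
    rw [Finset.mul_sum, ← Finset.sum_neg_distrib, Finset.sum_mul]
    refine Finset.sum_congr rfl fun i _ => ?_
    linear_combination (4 * (Real.pi : ℂ) ^ 2 * (x i : ℂ) ^ 2 * f x) * Complex.I_sq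

/-- A product rule for the inner product of a Lipschitz curve and a continuous curve. -/
lemma hasDerivAt_inner_of_lipschitz {H : Type*} [NormedAddCommGroup H] [InnerProductSpace ℂ H]
    {A F : ℝ → H} {t C : ℝ} {a b : ℂ} (hA : ∀ s, ‖A s - A t‖ ≤ C * |s - t|)
    (hF : ContinuousAt F t) (h1 : HasDerivAt (fun s => inner ℂ (A s) (F t)) a t)
    (h2 : HasDerivAt (fun s => inner ℂ (A t) (F s)) b t) :
    HasDerivAt (fun s => inner ℂ (A s) (F s)) (a + b) t := by
  -- The second-order remainder is O(|s - t|) · o(1), so neither curve need be differentiable in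
  -- norm.
  have h3 : HasDerivAt (fun s => inner ℂ (A s - A t) (F s - F t)) (0 : ℂ) t := by
    rw [hasDerivAt_iff_isLittleO]
    simp only [sub_self, inner_zero_left, smul_zero, sub_zero]
    have hO : (fun s => (inner ℂ (A s - A t) (F s - F t) : ℂ)) =O[nhds t]
        fun s => (s - t) * ‖F s - F t‖ := by
      refine Asymptotics.IsBigO.of_bound C (Filter.Eventually.of_forall fun s => ?_)
      rw [norm_mul, norm_norm, Real.norm_eq_abs, ← mul_assoc]
      exact (norm_inner_le_norm _ _).trans (mul_le_mul_of_nonneg_right (hA s) (norm_nonneg _))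
    refine hO.trans_isLittleO ?_
    have ho : (fun s => ‖F s - F t‖) =o[nhds t] fun _ => (1 : ℝ) := by
      rw [Asymptotics.isLittleO_one_iff]
      have := (hF.sub (continuousAt_const (y := F t))).norm
      simpa [ContinuousAt] using this
    simpa using (Asymptotics.isBigO_refl (fun s : ℝ => s - t) (nhds t)).mul_isLittleO ho
  have h4 := ((h1.add h2).sub_const (inner ℂ (A t) (F t))).add h3
  rw [add_zero] at h4
  refine h4.congr_of_eventuallyEq (Filter.Eventually.of_forall fun s => ?_)
  simp only [Pi.add_apply, inner_sub_left, inner_sub_right]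
  ring

/-- The unimodular symbol of the Schrödinger group. -/
noncomputable def schrodingerSymbol (s : ℝ) (η : EuclideanSpace ℝ (Fin d)) : ℂ :=
  Complex.exp (Complex.I * ((s * (4 * Real.pi ^ 2 * ‖η‖ ^ 2) : ℝ) : ℂ))

lemma contDiff_schrodingerSymbol (s : ℝ) :
    ContDiff ℝ (⊤ : ℕ∞) (schrodingerSymbol (d := d) s) := by
  unfold schrodingerSymbol
  have : ContDiff ℝ (⊤ : ℕ∞) fun η : EuclideanSpace ℝ (Fin d) =>
      ((s * (4 * Real.pi ^ 2 * ‖η‖ ^ 2) : ℝ) : ℂ) :=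
    Complex.ofRealCLM.contDiff.comp (contDiff_const.mul (contDiff_const.mul (contDiff_norm_sq ℝ)))
  exact (contDiff_const.mul this).cexp

lemma norm_schrodingerSymbol (s : ℝ) (η : EuclideanSpace ℝ (Fin d)) :
    ‖schrodingerSymbol s η‖ = 1 := by
  rw [schrodingerSymbol, mul_comm, Complex.norm_exp_ofReal_mul_I]

lemma conj_schrodingerSymbol (s : ℝ) (η : EuclideanSpace ℝ (Fin d)) :
    starRingEnd ℂ (schrodingerSymbol s η) = schrodingerSymbol (-s) η := by
  rw [schrodingerSymbol, schrodingerSymbol, ← Complex.exp_conj, map_mul,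
    Complex.conj_I, Complex.conj_ofReal]
  congr 1
  push_cast
  ring

lemma schrodingerSymbol_add (s t : ℝ) (η : EuclideanSpace ℝ (Fin d)) :
    schrodingerSymbol (s + t) η = schrodingerSymbol s η * schrodingerSymbol t η := by
  rw [schrodingerSymbol, schrodingerSymbol, schrodingerSymbol, ← Complex.exp_add]
  congr 1
  push_cast
  ring

lemma schrodingerSymbol_zero (η : EuclideanSpace ℝ (Fin d)) : schrodingerSymbol 0 η = 1 := by
  simp [schrodingerSymbol]

lemma norm_schrodingerSymbol_sub_le (s t : ℝ) (η : EuclideanSpace ℝ (Fin d)) :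
    ‖schrodingerSymbol s η - schrodingerSymbol t η‖ ≤ |s - t| * (4 * Real.pi ^ 2 * ‖η‖ ^ 2) := by
  have h : schrodingerSymbol s η - schrodingerSymbol t η =
      schrodingerSymbol t η * (schrodingerSymbol (s - t) η - 1) := by
    rw [mul_sub, ← schrodingerSymbol_add, mul_one, add_sub_cancel]
  rw [h, norm_mul, norm_schrodingerSymbol, one_mul, schrodingerSymbol]
  refine Real.norm_exp_I_mul_ofReal_sub_one_le.trans_eq ?_
  rw [norm_mul, Real.norm_eq_abs, Real.norm_of_nonneg (by positivity)]

/-- The equation is tested with `𝓕 f`, and the transform is then moved onto the solution. -/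
lemma IsSchrodingerSolution.hasDerivAt_integral_mul_fourier
    {u : ℝ → Lp ℂ 2 (volume : Measure (EuclideanSpace ℝ (Fin d)))} (hu : IsSchrodingerSolution u)
    (f g : 𝓢(EuclideanSpace ℝ (Fin d), ℂ))
    (hg : ∀ x, g x = -((4 * Real.pi ^ 2 * ‖x‖ ^ 2 : ℝ) : ℂ) * f x) (t : ℝ) :
    HasDerivAt (fun s : ℝ => ∫ η, f η * (𝓕 (u s)) η) (Complex.I * ∫ η, g η * (𝓕 (u t)) η) t := by
  obtain ⟨g', h1, h2⟩ := f.exists_laplacian_fourier_eq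
  obtain rfl : g = g' := SchwartzMap.ext fun x => (hg x).trans (h2 x).symm
  have h := hu.2 (𝓕 f) t
  rw [h1] at h
  simp_rw [integral_fourier_mul_Lp_eq] at h
  exact h

lemma inner_toLp_eq (f : 𝓢(EuclideanSpace ℝ (Fin d), ℂ))
    (v : Lp ℂ 2 (volume : Measure (EuclideanSpace ℝ (Fin d)))) :
    inner ℂ (f.toLp 2) v = ∫ η, starRingEnd ℂ (f η) * v η := by
  rw [L2.inner_def]
  refine integral_congr_ae ?_
  filter_upwards [f.coeFn_toLp 2] with η hη
  rw [hη, RCLike.inner_apply, mul_comm]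

/-- The Fourier transform of a solution of the Schrödinger equation. -/
theorem IsSchrodingerSolution.fourier_eq
    {u : ℝ → Lp ℂ 2 (volume : Measure (EuclideanSpace ℝ (Fin d)))} (hu : IsSchrodingerSolution u)
    (t : ℝ) : ∀ᵐ η, (𝓕 (u t)) η = schrodingerSymbol (-t) η * (𝓕 (u 0)) η := by
  have hli : ∀ s, LocallyIntegrable (𝓕 (u s) : Lp ℂ 2 (volume : Measure (EuclideanSpace ℝ (Fin d))))
      volume := fun s => (Lp.memLp _).locallyIntegrable (by norm_num)
  -- With the phase undone the claim is constancy in time, which can be tested weakly. The test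
  -- function Ψ s then moves with s, hence the product rule.
  suffices h : ∀ᵐ η, (𝓕 (u t)) η * schrodingerSymbol t η = (𝓕 (u 0)) η by
    filter_upwards [h] with η hη
    rw [← hη, mul_left_comm, ← schrodingerSymbol_add, neg_add_cancel, schrodingerSymbol_zero,
      mul_one]
  refine ae_eq_of_integral_contDiff_smul_eq ?_ (hli 0) fun φ hφ hφc => ?_
  · refine MemLp.locallyIntegrable (p := 2) ((Lp.memLp (𝓕 (u t))).of_le ?_ ?_) (by norm_num)
    · exact (Lp.memLp _).1.mul (contDiff_schrodingerSymbol t).continuous.aestronglyMeasurable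
    · exact ae_of_all _ fun η => by rw [norm_mul, norm_schrodingerSymbol, mul_one]
  have hc : ∀ {f : EuclideanSpace ℝ (Fin d) → ℂ}, HasCompactSupport fun η => f η * φ η :=
    fun {f} => (hφc.comp_left (g := Complex.ofReal) rfl).mul_left
  have hφ' : ContDiff ℝ (⊤ : ℕ∞) fun η => (φ η : ℂ) := Complex.ofRealCLM.contDiff.comp hφ
  have hq : ContDiff ℝ (⊤ : ℕ∞) fun η : EuclideanSpace ℝ (Fin d) =>
      (((4 * Real.pi ^ 2 * ‖η‖ ^ 2 : ℝ)) : ℂ) :=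
    Complex.ofRealCLM.contDiff.comp (contDiff_const.mul (contDiff_norm_sq ℝ))
  let Ψ : ℝ → 𝓢(EuclideanSpace ℝ (Fin d), ℂ) := fun s =>
    hc.toSchwartzMap ((contDiff_schrodingerSymbol s).mul hφ')
  let P : 𝓢(EuclideanSpace ℝ (Fin d), ℂ) := hc.toSchwartzMap (hq.mul hφ')
  let Q : ℝ → 𝓢(EuclideanSpace ℝ (Fin d), ℂ) := fun s =>
    hc.toSchwartzMap ((hq.neg.mul (contDiff_schrodingerSymbol s)).mul hφ')
  have hΨ : ∀ s η, Ψ s η = schrodingerSymbol s η * φ η := fun _ _ => rfl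
  have hP : ∀ η, P η = ((4 * Real.pi ^ 2 * ‖η‖ ^ 2 : ℝ) : ℂ) * φ η := fun _ => rfl
  have hQ : ∀ s η, Q s η = -((4 * Real.pi ^ 2 * ‖η‖ ^ 2 : ℝ) : ℂ) * schrodingerSymbol s η * φ η :=
    fun _ _ => rfl
  -- The sign -s compensates the conjugation in the first slot of the inner product.
  have hconj : ∀ s η, starRingEnd ℂ (Ψ (-s) η) = Ψ s η := fun s η => by
    rw [hΨ, hΨ, map_mul, conj_schrodingerSymbol, neg_neg, Complex.conj_ofReal]
  have hinner : ∀ s (v : Lp ℂ 2 (volume : Measure (EuclideanSpace ℝ (Fin d)))),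
      inner ℂ ((Ψ (-s)).toLp 2) v = ∫ η, Ψ s η * v η := fun s v => by
    simp_rw [inner_toLp_eq, hconj]
  have hint : ∀ (f : 𝓢(EuclideanSpace ℝ (Fin d), ℂ))
      (v : Lp ℂ 2 (volume : Measure (EuclideanSpace ℝ (Fin d)))),
      Integrable fun η => f η * v η := fun f v => (f.memLp 2).integrable_mul (Lp.memLp v)
  have hder : ∀ t, HasDerivAt (fun s => inner ℂ ((Ψ (-s)).toLp 2)
      (𝓕 (u s) : Lp ℂ 2 (volume : Measure (EuclideanSpace ℝ (Fin d))))) 0 t := fun t => by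
    have h1 : HasDerivAt (fun s => inner ℂ ((Ψ (-s)).toLp 2)
        (𝓕 (u t) : Lp ℂ 2 (volume : Measure (EuclideanSpace ℝ (Fin d)))))
        (-(Complex.I * ∫ η, Q t η * (𝓕 (u t)) η)) t := by
      have h := hasDerivAt_integral_exp_mul
        (b := fun η : EuclideanSpace ℝ (Fin d) => 4 * Real.pi ^ 2 * ‖η‖ ^ 2)
        (F := fun η => φ η * (𝓕 (u t)) η) (by fun_prop)
        ((hint (Ψ 0) (𝓕 (u t))).congr (ae_of_all _ fun η => by
          simp only [hΨ, schrodingerSymbol_zero, one_mul]))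
        ((hint P (𝓕 (u t))).congr (ae_of_all _ fun η => by
          simp only [hP, mul_assoc])) t
      refine (h.congr_deriv ?_).congr_of_eventuallyEq (Filter.Eventually.of_forall fun s => ?_)
      · rw [← integral_const_mul, ← integral_neg]
        refine integral_congr_ae (ae_of_all _ fun η => ?_)
        simp only [hQ, schrodingerSymbol]
        ring
      · simp only [hinner]
        refine integral_congr_ae (ae_of_all _ fun η => ?_)
        simp only [hΨ, schrodingerSymbol]
        ring
    have h2 : HasDerivAt (fun s => inner ℂ ((Ψ (-t)).toLp 2)
        (𝓕 (u s) : Lp ℂ 2 (volume : Measure (EuclideanSpace ℝ (Fin d)))))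
        (Complex.I * ∫ η, Q t η * (𝓕 (u t)) η) t := by
      simp_rw [hinner]
      exact hu.hasDerivAt_integral_mul_fourier (Ψ t) (Q t)
        (fun η => by rw [hQ, hΨ, mul_assoc]) t
    have hF : Continuous fun s => (𝓕 (u s) : Lp ℂ 2 (volume : Measure (EuclideanSpace ℝ (Fin d)))) :=
      (FourierTransform.fourierCLM ℂ
        (Lp ℂ 2 (volume : Measure (EuclideanSpace ℝ (Fin d))))).continuous.comp hu.1
    -- The derivative of the phase cancels the one from the equation. The Lipschitz bound in L²
    -- comes from |e^{ia} - e^{ib}| ≤ |a - b|.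
    have h3 := hasDerivAt_inner_of_lipschitz (C := ‖P.toLp 2‖) (fun s => ?_) hF.continuousAt h1 h2
    · rwa [neg_add_cancel] at h3
    · rw [mul_comm]
      refine Lp.norm_le_mul_norm_of_ae_le_mul ?_
      filter_upwards [Lp.coeFn_sub ((Ψ (-s)).toLp 2 volume) ((Ψ (-t)).toLp 2 volume),
        (Ψ (-s)).coeFn_toLp 2 volume, (Ψ (-t)).coeFn_toLp 2 volume, P.coeFn_toLp 2 volume]
        with η e1 e2 e3 e4
      rw [e1, Pi.sub_apply, e2, e3, e4, hΨ, hΨ, hP, ← sub_mul, norm_mul, norm_mul, ← mul_assoc]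
      refine mul_le_mul_of_nonneg_right ?_ (norm_nonneg _)
      refine (norm_schrodingerSymbol_sub_le _ _ η).trans_eq ?_
      rw [Complex.norm_of_nonneg (by positivity), ← abs_neg]
      congr 2
      ring
  have hconst := is_const_of_deriv_eq_zero (fun s => (hder s).differentiableAt)
    (fun s => (hder s).deriv) t 0
  simp only [hinner] at hconst
  convert hconst using 2
  · funext η
    rw [Complex.real_smul, hΨ]
    ring
  · funext η
    rw [Complex.real_smul, hΨ, schrodingerSymbol_zero, one_mul]

/-! ### Reduction to unit frequency scale -/

lemma integrable_comp_add_smul {F : Type*} [NormedAddCommGroup F]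
    {f : EuclideanSpace ℝ (Fin d) → F} (hf : Integrable f) (a : EuclideanSpace ℝ (Fin d)) {ρ : ℝ}
    (hρ : ρ ≠ 0) : Integrable fun ζ => f (a + ρ • ζ) :=
  (integrable_comp_smul_iff volume (fun ζ => f (a + ζ)) hρ).2 (hf.comp_add_left a)

lemma integral_comp_add_smul {F : Type*} [NormedAddCommGroup F] [NormedSpace ℝ F]
    (f : EuclideanSpace ℝ (Fin d) → F) (a : EuclideanSpace ℝ (Fin d)) {ρ : ℝ} (hρ : 0 < ρ) :
    ∫ ζ, f (a + ρ • ζ) = (ρ ^ d)⁻¹ • ∫ ζ, f ζ := by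
  rw [Measure.integral_comp_smul volume (fun ζ => f (a + ζ)) ρ, integral_add_left_eq_self f a,
    finrank_euclideanSpace_fin, abs_of_pos (by positivity)]

/-- The amplitude on the unit ball obtained by rescaling a function with frequencies in
`closedBall ξ ρ`. -/
noncomputable def unitAmp (f : EuclideanSpace ℝ (Fin d) → ℂ) (ξ : EuclideanSpace ℝ (Fin d))
    (ρ : ℝ) : EuclideanSpace ℝ (Fin d) → ℂ :=
  (Metric.closedBall 0 1).indicator fun ζ => f ((2 * Real.pi)⁻¹ • ξ + ρ • ζ)

lemma bandLimited_unitAmp (f : Lp ℂ 2 (volume : Measure (EuclideanSpace ℝ (Fin d))))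
    (ξ : EuclideanSpace ℝ (Fin d)) {ρ : ℝ} (hρ : 0 < ρ) : BandLimited (unitAmp f ξ ρ) := by
  have hm : AEStronglyMeasurable (fun ζ => f ((2 * Real.pi)⁻¹ • ξ + ρ • ζ)) volume :=
    ((Lp.stronglyMeasurable f).comp_measurable (by fun_prop)).aestronglyMeasurable
  have h2 : MemLp (fun ζ => f ((2 * Real.pi)⁻¹ • ξ + ρ • ζ)) 2 :=
    (memLp_two_iff_integrable_sq_norm hm).2
      (integrable_comp_add_smul ((Lp.memLp f).integrable_norm_pow (by norm_num)) _ hρ.ne')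
  exact ⟨h2.indicator Metric.isClosed_closedBall.measurableSet, fun ζ hζ =>
    Set.indicator_of_notMem (by simpa using hζ) _⟩

lemma unitAmp_ae_eq {f : Lp ℂ 2 (volume : Measure (EuclideanSpace ℝ (Fin d)))}
    {ξ : EuclideanSpace ℝ (Fin d)} {ρ : ℝ} (hρ : 0 < ρ)
    (hf : FourierSupportedIn f (Metric.closedBall ξ ρ)) :
    ∀ᵐ η, (𝓕 f) η = unitAmp (𝓕 f : Lp ℂ 2 (volume : Measure (EuclideanSpace ℝ (Fin d)))) ξ ρ
      (ρ⁻¹ • (η - (2 * Real.pi)⁻¹ • ξ)) := by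
  filter_upwards [hf] with η hη
  rw [unitAmp]
  by_cases h : ρ⁻¹ • (η - (2 * Real.pi)⁻¹ • ξ) ∈ Metric.closedBall 0 1
  · rw [Set.indicator_of_mem h, smul_inv_smul₀ hρ.ne', add_sub_cancel]
  · rw [Set.indicator_of_notMem h]
    refine hη fun hc => h ?_
    -- In Mathlib's frequency variable the ball has radius ρ/(2π), so dilating by ρ lands inside the
    -- unit ball with room to spare.
    have e : (2 * Real.pi) • η - ξ = (2 * Real.pi * ρ) • (ρ⁻¹ • (η - (2 * Real.pi)⁻¹ • ξ)) := by
      rw [mul_smul (2 * Real.pi) ρ, smul_inv_smul₀ hρ.ne', smul_sub, smul_inv_smul₀ (by positivity)]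
    rw [mem_closedBall_iff_norm, e, norm_smul, Real.norm_of_nonneg (by positivity)] at hc
    rw [mem_closedBall_zero_iff]
    have hπ : (1 : ℝ) ≤ 2 * Real.pi := by linarith [Real.pi_gt_three]
    by_contra hlt
    rw [not_le] at hlt
    nlinarith [norm_nonneg (ρ⁻¹ • (η - (2 * Real.pi)⁻¹ • ξ)), mul_pos hρ (sub_pos.2 hlt),
      mul_nonneg hρ.le (sub_nonneg.2 hπ)]

/-- The Galilean transform of a wave with frequencies in the unit ball. -/
noncomputable def galileanWave (G : EuclideanSpace ℝ (Fin d) → ℂ) (ξ : EuclideanSpace ℝ (Fin d))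
    (ρ t : ℝ) (x : EuclideanSpace ℝ (Fin d)) : ℂ :=
  ρ ^ d * (Complex.exp (Complex.I * ((inner ℝ x ξ - t * ‖ξ‖ ^ 2 : ℝ) : ℂ)) *
    wave G (ρ ^ 2 * t) (ρ • (x - (2 * t) • ξ)))

lemma continuous_galileanWave {G : EuclideanSpace ℝ (Fin d) → ℂ} (hG : BandLimited G)
    (ξ : EuclideanSpace ℝ (Fin d)) (ρ t : ℝ) : Continuous (galileanWave G ξ ρ t) := by
  have h := continuous_wave_apply hG (ρ ^ 2 * t)
  unfold galileanWave
  fun_prop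

lemma norm_sq_galileanWave (G : EuclideanSpace ℝ (Fin d) → ℂ) (ξ : EuclideanSpace ℝ (Fin d))
    (ρ t : ℝ) (x : EuclideanSpace ℝ (Fin d)) :
    ‖galileanWave G ξ ρ t x‖ ^ 2 =
      (ρ ^ d) ^ 2 * ‖wave G (ρ ^ 2 * t) (ρ • (x - (2 * t) • ξ))‖ ^ 2 := by
  rw [galileanWave, norm_mul, norm_exp_I_mul_ofReal_mul, mul_pow, norm_pow, Complex.norm_real,
    Real.norm_eq_abs, ← abs_pow, sq_abs]

lemma integral_norm_sq_galileanWave {G : EuclideanSpace ℝ (Fin d) → ℂ} (hG : BandLimited G)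
    (ξ : EuclideanSpace ℝ (Fin d)) {ρ : ℝ} (hρ : 0 < ρ) (t : ℝ) :
    ∫ x, ‖galileanWave G ξ ρ t x‖ ^ 2 = ρ ^ d * ∫ ζ, ‖G ζ‖ ^ 2 := by
  simp_rw [norm_sq_galileanWave, integral_const_mul]
  have h := integral_comp_add_smul (fun y => ‖wave G (ρ ^ 2 * t) y‖ ^ 2)
    (-(ρ • (2 * t) • ξ)) hρ
  have e : ∀ x : EuclideanSpace ℝ (Fin d), -(ρ • (2 * t) • ξ) + ρ • x = ρ • (x - (2 * t) • ξ) :=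
    fun x => by rw [smul_sub]; abel
  simp_rw [e] at h
  rw [h, integral_norm_sq_wave hG, smul_eq_mul]
  field_simp

/-- Substitute η = ξ/(2π) + ρζ and expand |η|²: the constant term gives the plane-wave phase, the
cross term the drift 2tξ, and the quadratic term the time ρ²t. -/
lemma fourierInv_eq_galileanWave (G : EuclideanSpace ℝ (Fin d) → ℂ)
    (ξ : EuclideanSpace ℝ (Fin d)) {ρ : ℝ} (hρ : 0 < ρ) (t : ℝ) :
    𝓕⁻ (fun η => schrodingerSymbol (-t) η * G (ρ⁻¹ • (η - (2 * Real.pi)⁻¹ • ξ))) =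
      galileanWave G ξ ρ t := by
  funext x
  rw [Real.fourierInv_eq', galileanWave]
  have h := integral_comp_add_smul (fun η : EuclideanSpace ℝ (Fin d) =>
    Complex.exp (↑(2 * Real.pi * inner ℝ η x) * Complex.I) •
      (schrodingerSymbol (-t) η * G (ρ⁻¹ • (η - (2 * Real.pi)⁻¹ • ξ)))) ((2 * Real.pi)⁻¹ • ξ) hρ
  rw [eq_inv_smul_iff₀ (by positivity)] at h
  rw [← h, Complex.real_smul, Complex.ofReal_pow]
  congr 1
  rw [wave, ← integral_const_mul]
  refine integral_congr_ae (ae_of_all _ fun ζ => ?_)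
  simp only [add_sub_cancel_left, inv_smul_smul₀ hρ.ne', smul_eq_mul, schrodingerSymbol]
  rw [← mul_assoc _ _ (G ζ), ← mul_assoc _ _ (G ζ), ← Complex.exp_add, ← Complex.exp_add, mul_comm _ Complex.I,
    ← mul_add, ← mul_add, ← Complex.ofReal_add, ← Complex.ofReal_add]
  congr 4
  rw [norm_add_sq_real, norm_smul, norm_smul, mul_pow, mul_pow]
  simp only [inner_add_left, inner_smul_left, inner_smul_right, inner_sub_left,
    RCLike.conj_to_real, Real.norm_eq_abs, sq_abs]
  rw [real_inner_comm x ξ, real_inner_comm x ζ]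
  have := Real.pi_ne_zero
  field_simp
  ring

theorem corollary2 (d : ℕ) :
    ∃ r V C : ℝ, 0 < r ∧ 0 < V ∧ 0 < C ∧
      ∀ (ξ : EuclideanSpace ℝ (Fin d)) (ρ : ℝ), 0 < ρ →
      ∀ u : ℝ → Lp ℂ 2 (volume : Measure (EuclideanSpace ℝ (Fin d))),
        IsSchrodingerSolution u →
        FourierSupportedIn (u 0) (Metric.closedBall ξ ρ) →
        ∃ v : ℝ → EuclideanSpace ℝ (Fin d) → ℂ,
          (∀ t, Continuous (v t)) ∧
          (∀ t, u t =ᵐ[volume] v t) ∧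
          ∀ T : ℝ, 0 < T →
            ∃ (γ : ℕ → ℝ → EuclideanSpace ℝ (Fin d)) (w : ℕ → ℝ),
              (∀ i, Differentiable ℝ (γ i)) ∧
              (∀ i t, ‖deriv (γ i) t - (2 : ℝ) • ξ‖ < V * ρ) ∧
              (∀ i, 0 ≤ w i) ∧
              Summable w ∧
              (∀ (x : EuclideanSpace ℝ (Fin d)) (t : ℝ), t ∈ Set.Icc (-T) T →
                ‖v t x‖ ^ 2 ≤
                  ∑' i, w i * (tube (γ i) (r * ρ⁻¹)).indicator (fun _ => (1 : ℝ)) (x, t)) ∧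
              (∀ t : ℝ, ∑' i, (r * ρ⁻¹) ^ d * w i ≤ C * ∫ x, ‖v t x‖ ^ 2) := by
  obtain ⟨r, V, C, hr, hV, hC, h⟩ := exists_tubes_wave d
  -- The tube factor (r/ρ)^d and the squared amplitude ρ^{2d} leave r^d ρ^d. The factor ρ^d is
  -- absorbed by ∫|v t|² = ρ^d ∫|G|², which is independent of t, so the bound also holds outside
  -- [-T, T].
  refine ⟨r, V, r ^ d * C, hr, hV, by positivity, fun ξ ρ hρ u hu hsupp => ?_⟩
  set G := unitAmp (𝓕 (u 0) : Lp ℂ 2 (volume : Measure (EuclideanSpace ℝ (Fin d)))) ξ ρ with hGdef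
  have hG : BandLimited G := bandLimited_unitAmp _ ξ hρ
  refine ⟨galileanWave G ξ ρ, fun t => continuous_galileanWave hG ξ ρ t, fun t => ?_,
    fun T hT => ?_⟩
  · rw [← fourierInv_eq_galileanWave G ξ hρ t]
    refine fourierInv_ae_eq_of_integrable_of_memLp ?_ (u t) ?_
    · have h1 : Integrable fun η => G (ρ⁻¹ • (η - (2 * Real.pi)⁻¹ • ξ)) :=
        ((integrable_comp_smul_iff volume G (inv_ne_zero hρ.ne')).2 hG.integrable).comp_sub_right _
      refine h1.mono ((contDiff_schrodingerSymbol _).continuous.aestronglyMeasurable.mul h1.1)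
        (ae_of_all _ fun η => ?_)
      rw [norm_mul, norm_schrodingerSymbol, one_mul]
    · filter_upwards [hu.fourier_eq t, unitAmp_ae_eq hρ hsupp] with η h1 h2
      rw [h1, h2]
  obtain ⟨γ, w, hγd, hγ, hw0, hws, hle, hsum⟩ := h G hG (ρ ^ 2 * T) (by positivity)
  -- Parabolic rescaling: lengths shrink by ρ and times by ρ², so speeds relative to the drift 2ξ
  -- are multiplied by ρ.
  have hder : ∀ i t, HasDerivAt (fun t => (2 * t) • ξ + ρ⁻¹ • γ i (ρ ^ 2 * t))
      ((2 : ℝ) • ξ + ρ • deriv (γ i) (ρ ^ 2 * t)) t := fun i t => by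
    have h1 : HasDerivAt (fun t : ℝ => 2 * t) 2 t := by
      simpa using (hasDerivAt_id t).const_mul (2 : ℝ)
    have h2 : HasDerivAt (fun t : ℝ => ρ ^ 2 * t) (ρ ^ 2) t := by
      simpa using (hasDerivAt_id t).const_mul (ρ ^ 2)
    have h3 := ((hγd i (ρ ^ 2 * t)).hasDerivAt.scomp t h2).const_smul ρ⁻¹
    rw [smul_smul, show ρ⁻¹ * ρ ^ 2 = ρ by field_simp] at h3
    exact (h1.smul_const ξ).add h3
  refine ⟨fun i t => (2 * t) • ξ + ρ⁻¹ • γ i (ρ ^ 2 * t), fun i => (ρ ^ d) ^ 2 * w i,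
    fun i t => (hder i t).differentiableAt, fun i t => ?_, fun i => ?_, hws.mul_left _,
    fun x t ht => ?_, fun t => ?_⟩
  · rw [(hder i t).deriv, add_sub_cancel_left, norm_smul, Real.norm_of_nonneg hρ.le, mul_comm]
    exact mul_lt_mul_of_pos_right (hγ i _) hρ
  · exact mul_nonneg (by positivity) (hw0 i)
  · have hρ2 : 0 < ρ ^ 2 := by positivity
    have h1 := hle (ρ • (x - (2 * t) • ξ)) (ρ ^ 2 * t)
      ⟨by nlinarith [ht.1], mul_le_mul_of_nonneg_left ht.2 hρ2.le⟩
    rw [norm_sq_galileanWave]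
    simp_rw [mul_assoc]
    rw [tsum_mul_left]
    refine mul_le_mul_of_nonneg_left (h1.trans_eq (tsum_congr fun i => ?_)) (by positivity)
    congr 1
    have hmem : (ρ • (x - (2 * t) • ξ), ρ ^ 2 * t) ∈ tube (γ i) r ↔
        (x, t) ∈ tube (fun t => (2 * t) • ξ + ρ⁻¹ • γ i (ρ ^ 2 * t)) (r * ρ⁻¹) := by
      have e : ρ • (x - (2 * t) • ξ) - γ i (ρ ^ 2 * t) =
          ρ • (x - ((2 * t) • ξ + ρ⁻¹ • γ i (ρ ^ 2 * t))) := by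
        simp only [smul_sub, smul_add, smul_inv_smul₀ hρ.ne']
        abel
      simp only [tube, Set.mem_ofPred_eq]
      rw [e, norm_smul, Real.norm_of_nonneg hρ.le, ← div_eq_mul_inv, le_div_iff₀ hρ, mul_comm]
    by_cases hx : (x, t) ∈ tube (fun t => (2 * t) • ξ + ρ⁻¹ • γ i (ρ ^ 2 * t)) (r * ρ⁻¹)
    · rw [Set.indicator_of_mem hx, Set.indicator_of_mem (hmem.2 hx)]
    · rw [Set.indicator_of_notMem hx, Set.indicator_of_notMem fun hc => hx (hmem.1 hc)]
  · rw [tsum_mul_left, tsum_mul_left, integral_norm_sq_galileanWave hG ξ hρ]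
    calc (r * ρ⁻¹) ^ d * ((ρ ^ d) ^ 2 * ∑' i, w i) = r ^ d * ρ ^ d * ∑' i, w i := by
          rw [mul_pow, inv_pow]
          field_simp
      _ ≤ r ^ d * ρ ^ d * (C * ∫ ζ, ‖G ζ‖ ^ 2) := mul_le_mul_of_nonneg_left hsum (by positivity)
      _ = _ := by ring
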